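/- Let $\tfrac12<\sigma<1$, $m>0$, and let $f:\mathbb R\to\mathbb C$ be in $L^1(\mathbb R)$. For $x>0$ put $$k(x)=\sum_{n\ge1}d_{1/2}(n)e^{-nx}-x^{-3/2}\,\frac{\sqrt{\pi}}{2}\,\zeta\!\left(\tfrac32\right)-x^{-1}\zeta\!\left(\tfrac12\right),\qquad d_r(n)=\sum_{d\mid n}d^{\,r},$$ and define $$\bar I_{\sigma,m}(x)=e^{-imx}\int_{-\infty}^{\infty}f(u)\,e^{\sigma(x-u)}k(e^{x-u})\,du .$$ For $g\in L^1(\mathbb R)$ write $\mathfrak Fg(t)=\frac1{\sqrt{2\pi}}\int_{-\infty}^\infty e^{-itx}g(x)\,dx$, and for real $v\in L^2(\mathbb R)$ write $\mathfrak Hv(y)=\frac1\pi\,\mathrm{PV}\!\int_{-\infty}^\infty\frac{v(x)}{x-y}\,dx$ (for almost every $y$). The integral defining $\bar I_{\sigma,m}(x)$ converges absolutely for every real $x$, and $\bar I_{\sigma,m}\in L^1(\mathbb R)\cap L^2(\mathbb R)$. Consider the following conditions. * (A) There are a function $F$ analytic in the upper half-plane $\Im z>0$ and a constant $C>0$ with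 $\int_{-\infty}^\infty|F(x+iy)|^2dx\le Ce^{2my}$ for all $y>0$, such that $F(z)\to\bar I_{\sigma,m}(x)$ as $z\to x$ within the open upper half-plane, for every real $x$. * (A′) The same as (A), with the limit replaced by: $F(x+iy)\to\bar I_{\sigma,m}(x)$ as $y\to0^+$ for almost every real $x$. * (i) $\bar I_{\sigma,m}=v-iw$ with real-valued $v,w\in L^2(\mathbb R)$ that are Hilbert transforms of each other, i.e. $w=\mathfrak Hv$ and $v=-\mathfrak Hw$ almost everywhere. * (ii) $\mathfrak F\bar I_{\sigma,m}(t)=0$ for all $t<-m$. * (iii) $\mathfrak Ff(t)=0$ for all $t<0$. Then: 1. (A), (A′) and (ii) are equivalent. 2. (i) implies (A); if $f$ is real-valued, then (A) and (i) are equivalent. 3. If the Riemann hypothesis is true, then (A) and (iii) are equivalent. -/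

import Mathlib

open MeasureTheory Filter Topology

noncomputable section

/-- The divisor function `d_r(n) = ∑_{d ∣ n} d ^ r`. -/
def divisorPow (r : ℝ) (n : ℕ) : ℝ := ∑ d ∈ n.divisors, (d : ℝ) ^ r

/-- The kernel
`k(x) = ∑_{n ≥ 1} d_{1/2}(n) e^{-nx} - x^{-3/2} (√π / 2) ζ(3/2) - x^{-1} ζ(1/2)` for `x > 0`. -/
def kernelK (x : ℝ) : ℂ :=
  ((∑' n : ℕ, divisorPow (1 / 2) (n + 1) * Real.exp (-((n + 1 : ℕ) : ℝ) * x) : ℝ) : ℂ)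
    - ((x ^ (-(3 / 2) : ℝ) * (Real.sqrt Real.pi / 2) : ℝ) : ℂ) * riemannZeta (3 / 2)
    - ((x⁻¹ : ℝ) : ℂ) * riemannZeta (1 / 2)

/-- The function `x ↦ e^{σx} k(e^x)` on the real line. -/
def expKernel (σ : ℝ) (x : ℝ) : ℂ := (Real.exp (σ * x) : ℂ) * kernelK (Real.exp x)

/-- The convolution `I_σ(x) = ∫ f(u) e^{σ(x-u)} k(e^{x-u}) du`. -/
def convI (f : ℝ → ℂ) (σ : ℝ) (x : ℝ) : ℂ := ∫ u : ℝ, f u * expKernel σ (x - u)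

/-- `Ī_{σ,m}(x) = e^{-imx} I_σ(x)`. -/
def convIbar (f : ℝ → ℂ) (σ m : ℝ) (x : ℝ) : ℂ :=
  Complex.exp (-(Complex.I * m * x)) * convI f σ x

/-- The Fourier transform `(2π)^{-1/2} ∫ e^{-itx} g(x) dx` of an integrable function. -/
def fourierT (g : ℝ → ℂ) (t : ℝ) : ℂ :=
  ((1 / Real.sqrt (2 * Real.pi) : ℝ) : ℂ) *
    ∫ x : ℝ, Complex.exp (-(Complex.I * t * x)) * g x

/-- `w` is the Hilbert transform of `v`: for almost every `y`, the principal value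
`(1/π) PV ∫ v(x) / (x - y) dx` exists and equals `w(y)`. -/
def IsHilbertTransform (v w : ℝ → ℝ) : Prop :=
  ∀ᵐ y : ℝ, Tendsto
    (fun ε : ℝ => (1 / Real.pi) * ∫ x in {x : ℝ | ε < |x - y|}, v x / (x - y))
    (𝓝[>] 0) (𝓝 (w y))

/-- `g = v - i w` with real `v, w ∈ L²` that are Hilbert transforms of each other. As the Hilbert
operator `H` satisfies `H H = -1`, this means `w = H v` and `v = -H w`. -/
def IsHilbertPair (g : ℝ → ℂ) : Prop :=
  ∃ v w : ℝ → ℝ, MemLp v 2 volume ∧ MemLp w 2 volume ∧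
    (∀ x, g x = (v x : ℂ) - Complex.I * (w x : ℂ)) ∧
    IsHilbertTransform v w ∧ IsHilbertTransform w (fun x => -v x)

/-- `F` is analytic in the upper half-plane, and `∫ |F(x+iy)|² dx ≤ C e^{2my}` for all `y > 0`
with some constant `C`. -/
def AnalyticGrowth (m : ℝ) (F : ℂ → ℂ) : Prop :=
  DifferentiableOn ℂ F {z : ℂ | 0 < z.im} ∧
  ∃ C : ℝ, 0 < C ∧ ∀ y : ℝ, 0 < y →
    ∫⁻ x : ℝ, ‖F ((x : ℂ) + Complex.I * (y : ℂ))‖ₑ ^ 2 ≤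
      ENNReal.ofReal (C * Real.exp (2 * m * y))

/-- `g` is the boundary function of such an `F` in the strong sense: for every real `x`,
`F(z) → g(x)` as `z → x` without restriction within the open upper half-plane. -/
def IsStrongBoundaryValue (m : ℝ) (g : ℝ → ℂ) : Prop :=
  ∃ F : ℂ → ℂ, AnalyticGrowth m F ∧
    ∀ x : ℝ, Tendsto F (𝓝[{z : ℂ | 0 < z.im}] (x : ℂ)) (𝓝 (g x))

/-- `g` is the boundary function of such an `F` in the weak sense: for almost every real `x`,
`F(x+iy) → g(x)` as `y → 0+`. -/
def IsWeakBoundaryValue (m : ℝ) (g : ℝ → ℂ) : Prop :=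
  ∃ F : ℂ → ℂ, AnalyticGrowth m F ∧
    ∀ᵐ x : ℝ, Tendsto (fun y : ℝ => F ((x : ℂ) + Complex.I * (y : ℂ))) (𝓝[>] 0) (𝓝 (g x))

end

/-!
The kernel is built by applying one operation twice. For `φ` with suitable decay, first-order
Euler–Maclaurin summation gives `∑_{m ≥ 1} φ(m x) - x⁻¹ ∫ φ = ∫_0^∞ {u / x} φ'(u) du`
(`MuntzData.hasSum`), and Müntz's formula says that the Mellin transform of this function of `x` is
`ζ(s)` times that of `φ` in the part of the strip `0 < Re s < 1` where `φ` has an absolutely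
convergent Mellin transform (`MuntzData.hasMellin_muntz`). Here it follows from Fubini and
`∫_0^∞ {v} v^{-s-1} dv = -ζ(s) / s` (`hasMellin_fract_neg`). Starting with `√u e^{-u}` one obtains
`φ(x) = ∑ √d e^{-d x} - Γ(3/2) x^{-3/2}`, and starting with this `φ` one obtains `k`
(`kernelK_eq`). Hence `k` has the Mellin transform `Γ(s) ζ(s) ζ(s - 1/2)` in `1/2 < Re s < 1`
(`hasMellin_kernelK`). Moreover `e^{σx} k(e^x)` is real, continuous, bounded and integrable, and so
the convolution `I = f * e^{σ·} k(e^·)` is continuous, bounded and integrable, with Fourier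
transform `𝔉f(t) · Γ(s) ζ(s) ζ(s - 1/2)`, `s = σ - it`, up to normalization. Under the Riemann
hypothesis the second factor has no zeros, so `I` has the same vanishing frequencies as `f`; this
makes (ii) and (iii) equivalent, as (ii) says that `I = e^{imx} Ī` has no negative frequencies.

Condition (A′) says that `I` is a boundary function of some `G(z) = e^{imz} F(z)` in the Hardy space
`H²` of the upper half-plane. Shifting the line of integration to `i∞` shows that `G` is orthogonal
on horizontal lines to `e^{-itz} / (1 - iεz)²` for `t < 0`, and the `L²` bound allows one to let
`Im z → 0` and then `ε → 0`, so `I` has no negative frequencies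
(`integral_exp_mul_boundary_eq_zero`). Conversely, if `I` has no negative frequencies, its Cauchy
integral vanishes in the lower half-plane and equals `2πi` times the Poisson integral in the upper
one. The Poisson integral is thus analytic (`differentiableOn_poissonExt`); its `L²` norms on
horizontal lines are bounded by that of `I`, and it has unrestricted limits at every boundary point,
as `I` is bounded and continuous. This is the strong form (A).

If `Ī = v - i 𝔥v` with the Hilbert transform `𝔥v` of `v`, then `Ī` is the boundary function of
`(πi)⁻¹ ∫ v(u) / (u - z) du = P_y v - i Q_y v`, where `P_y` and `Q_y` are the Poisson and conjugate
Poisson integrals: at every point where the principal value exists, `Q_y v` converges to it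
(`tendsto_conjPoisson`). The `L²` bound comes from `∫ (P_y v - i Q_y v)² dx = 0`, which gives
`‖Q_y v‖₂ = ‖P_y v‖₂` (`lintegral_sq_hilbertExt_le`). So (i) implies (A′). If `f` is real, then so
is `I`, and (A) makes its Fourier transform vanish on both half-lines; then `I = 0`, and (i) holds
trivially.
-/

noncomputable section

/-! ### The Mellin transform of the sawtooth function -/

/-- The fractional part, cut off to `(1, ∞)`. -/
def fractTail (v : ℝ) : ℂ := (Set.Ioi (1 : ℝ)).indicator (fun v => ((Int.fract v : ℝ) : ℂ)) v

lemma measurable_fractTail : Measurable fractTail :=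
  (Complex.measurable_ofReal.comp measurable_fract).indicator measurableSet_Ioi

lemma norm_ofReal_fract_le (v : ℝ) : ‖((Int.fract v : ℝ) : ℂ)‖ ≤ 1 := by
  rw [Complex.norm_real, Real.norm_of_nonneg (Int.fract_nonneg v)]
  exact (Int.fract_lt_one v).le

lemma norm_fractTail_le (v : ℝ) : ‖fractTail v‖ ≤ 1 := by
  unfold fractTail
  by_cases h : v ∈ Set.Ioi (1 : ℝ)
  · rw [Set.indicator_of_mem h]; exact norm_ofReal_fract_le v
  · rw [Set.indicator_of_notMem h]; simp

lemma locallyIntegrableOn_fractTail : LocallyIntegrableOn fractTail (Set.Ioi 0) := by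
  have h : LocallyIntegrable fractTail volume :=
    (locallyIntegrable_const (1 : ℝ)).mono measurable_fractTail.aestronglyMeasurable
      (Eventually.of_forall fun v => by simpa using norm_fractTail_le v)
  exact h.locallyIntegrableOn _

lemma fractTail_isBigO_top : fractTail =O[atTop] (fun x : ℝ => x ^ (-(0 : ℝ))) := by
  refine Asymptotics.IsBigO.of_bound 1 (Eventually.of_forall fun v => ?_)
  simpa using norm_fractTail_le v

lemma fractTail_isBigO_zero (b : ℝ) : fractTail =O[𝓝[>] 0] (fun x : ℝ => x ^ (-b)) := by
  refine Asymptotics.IsBigO.of_bound 1 ?_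
  filter_upwards [Ioo_mem_nhdsGT (zero_lt_one' ℝ)] with v hv
  have : fractTail v = 0 := Set.indicator_of_notMem (by simpa using hv.2.le) _
  rw [this]; simp

lemma mellinConvergent_fractTail {s : ℂ} (hs : s.re < 0) : MellinConvergent fractTail s :=
  mellinConvergent_of_isBigO_rpow locallyIntegrableOn_fractTail fractTail_isBigO_top hs
    (fractTail_isBigO_zero (s.re - 1)) (by linarith)

lemma differentiableAt_mellin_fractTail {s : ℂ} (hs : s.re < 0) :
    DifferentiableAt ℂ (mellin fractTail) s :=
  mellin_differentiableAt_of_isBigO_rpow locallyIntegrableOn_fractTail fractTail_isBigO_top hs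
    (fractTail_isBigO_zero (s.re - 1)) (by linarith)

lemma mellin_fractTail_eq (s : ℂ) :
    mellin fractTail s = ∫ t in Set.Ioi (1 : ℝ), (t : ℂ) ^ (s - 1) * ((Int.fract t : ℝ) : ℂ) := by
  have h : ∀ t : ℝ, (t : ℂ) ^ (s - 1) • fractTail t =
      (Set.Ioi (1 : ℝ)).indicator (fun t : ℝ => (t : ℂ) ^ (s - 1) * ((Int.fract t : ℝ) : ℂ)) t := by
    intro t
    by_cases ht : t ∈ Set.Ioi (1 : ℝ)
    · simp [fractTail, Set.indicator_of_mem ht]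
    · simp [fractTail, Set.indicator_of_notMem ht]
  simp_rw [mellin, h]
  rw [setIntegral_indicator measurableSet_Ioi]
  congr 2
  ext t; simp only [Set.mem_inter_iff, Set.mem_Ioi]; constructor
  · exact fun h => h.2
  · exact fun h => ⟨by linarith, h⟩

lemma mellin_fractTail_of_one_lt {s : ℂ} (hs : 1 < s.re) :
    riemannZeta s = s / (s - 1) - s * mellin fractTail (-s) := by
  have hs1 : s - 1 ≠ 0 := by
    intro h; rw [sub_eq_zero] at h; rw [h] at hs; simp at hs
  have hO : (fun n : ℕ => ∑ k ∈ Finset.Icc 1 n, ((fun _ => 1 : ℕ → ℝ) k)) =O[atTop]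
      fun n : ℕ => (n : ℝ) ^ (1 : ℝ) := by
    refine Asymptotics.IsBigO.of_bound 1 (Eventually.of_forall fun n => ?_)
    simp
  have h1 := LSeries_eq_mul_integral_of_nonneg (fun _ => 1) zero_le_one hs hO (by simp)
  have hz : LSeries (fun _ => ((1 : ℝ) : ℂ)) s = riemannZeta s := by
    rw [Complex.ofReal_one]
    exact LSeries_one_eq_riemannZeta hs
  rw [hz] at h1
  have hf : IntegrableOn (fun t : ℝ => (t : ℂ) ^ (-s - 1) * ((Int.fract t : ℝ) : ℂ)) (Set.Ioi 1) := by
    have h := (mellinConvergent_fractTail (s := -s) (by simp; linarith)).mono_set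
      (Set.Ioi_subset_Ioi (zero_le_one' ℝ))
    refine h.congr_fun (fun t ht => ?_) measurableSet_Ioi
    simp [fractTail, Set.indicator_of_mem ht]
  have hp : IntegrableOn (fun t : ℝ => (t : ℂ) ^ (-s)) (Set.Ioi 1) :=
    integrableOn_Ioi_cpow_of_lt (by simp; linarith) one_pos
  have hi : ∫ t in Set.Ioi (1 : ℝ), (∑ k ∈ Finset.Icc 1 ⌊t⌋₊, ((1 : ℝ) : ℂ)) * (t : ℂ) ^ (-(s + 1)) =
      ∫ t in Set.Ioi (1 : ℝ), ((t : ℂ) ^ (-s) - (t : ℂ) ^ (-s - 1) * ((Int.fract t : ℝ) : ℂ)) := by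
    refine setIntegral_congr_fun measurableSet_Ioi (fun t ht => ?_)
    have ht0 : (0 : ℝ) < t := lt_trans one_pos ht
    have h2 : ((⌊t⌋₊ : ℕ) : ℂ) = (t : ℂ) - ((Int.fract t : ℝ) : ℂ) := by
      rw [← Complex.ofReal_sub, Int.self_sub_fract]
      rw [← natCast_floor_eq_intCast_floor ht0.le]; simp
    have h3 : (t : ℂ) ^ (-s) = (t : ℂ) ^ (-s - 1) * t := by
      rw [Complex.cpow_sub _ _ (by exact_mod_cast ht0.ne'), Complex.cpow_one]
      field_simp [show (t : ℂ) ≠ 0 by exact_mod_cast ht0.ne']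
    simp only [Complex.ofReal_one, Finset.sum_const, Nat.card_Icc, add_tsub_cancel_right,
      nsmul_eq_mul, mul_one]
    rw [h2, h3, neg_add']; ring
  rw [hi, integral_sub hp hf, integral_Ioi_cpow_of_lt (by simp; linarith) one_pos,
    ← mellin_fractTail_eq] at h1
  rw [h1]
  have : -s + 1 ≠ 0 := by intro h; apply hs1; linear_combination -h
  simp only [Complex.ofReal_one, Complex.one_cpow]
  field_simp
  ring

/-- The representation `ζ(s) = s / (s - 1) - s ∫_1^∞ {v} v^{-s-1} dv` persists in `0 < Re s` by
analytic continuation; it is stated with the entire function `ζ₁(s) = (s - 1) ζ(s)`. -/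
lemma riemannZeta₁_eq_mellin_fractTail {s : ℂ} (hs : 0 < s.re) :
    riemannZeta₁ s = s - (s - 1) * s * mellin fractTail (-s) := by
  have hopen : IsOpen {s : ℂ | 0 < s.re} := isOpen_lt continuous_const Complex.continuous_re
  have hA : AnalyticOnNhd ℂ riemannZeta₁ {s : ℂ | 0 < s.re} :=
    DifferentiableOn.analyticOnNhd (differentiable_riemannZeta₁.differentiableOn) hopen
  have hB : AnalyticOnNhd ℂ (fun s => s - (s - 1) * s * mellin fractTail (-s))
      {s : ℂ | 0 < s.re} := by
    refine DifferentiableOn.analyticOnNhd (fun z hz => ?_) hopen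
    have hz' : (0 : ℝ) < z.re := hz
    have : DifferentiableAt ℂ (fun s => mellin fractTail (-s)) z :=
      (differentiableAt_mellin_fractTail (s := -z) (by simpa using hz')).comp z
        differentiableAt_id.neg
    exact (by fun_prop : DifferentiableAt ℂ
      (fun s => s - (s - 1) * s * mellin fractTail (-s)) z).differentiableWithinAt
  have hpre : IsPreconnected {s : ℂ | 0 < s.re} := (convex_halfSpace_re_gt 0).isPreconnected
  refine hA.eqOn_of_preconnected_of_eventuallyEq hB hpre (z₀ := 2) (by simp) ?_ hs
  have h2 : ∀ᶠ z : ℂ in 𝓝 2, 1 < z.re :=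
    (isOpen_lt continuous_const Complex.continuous_re).mem_nhds (by simp)
  filter_upwards [h2] with z hz
  have hz1 : z - 1 ≠ 0 := by
    intro h; rw [sub_eq_zero] at h; rw [h] at hz; simp at hz
  have h := mellin_fractTail_of_one_lt hz
  rw [riemannZeta_eq_inv_sub_mul (sub_ne_zero.1 hz1)] at h
  field_simp at h
  linear_combination h

/-- For `0 < Re s < 1`, `∫_0^∞ {v} v^{-s-1} dv = -ζ(s) / s`. -/
lemma hasMellin_fract_neg {s : ℂ} (hs0 : 0 < s.re) (hs1 : s.re < 1) :
    HasMellin (fun v : ℝ => ((Int.fract v : ℝ) : ℂ)) (-s) (-riemannZeta s / s) := by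
  have h1 := hasMellin_cpow_Ioc 1 (s := -s) (by simp; linarith)
  have h2 := mellinConvergent_fractTail (s := -s) (by simpa using hs0)
  have hadd := hasMellin_add h1.1 h2
  have hs : s ≠ 0 := by rintro rfl; simp at hs0
  have hs' : s - 1 ≠ 0 := by
    intro h; rw [sub_eq_zero] at h; rw [h] at hs1; simp at hs1
  have hae : (fun t : ℝ => (t : ℂ) ^ (-s - 1) • ((Set.Ioc 0 1).indicator
      (fun t : ℝ => (t : ℂ) ^ (1 : ℂ)) t + fractTail t))
      =ᵐ[volume.restrict (Set.Ioi 0)] fun t => (t : ℂ) ^ (-s - 1) • ((Int.fract t : ℝ) : ℂ) := by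
    have h1 : ∀ᵐ t : ℝ, t ≠ 1 := by simp [ae_iff]
    filter_upwards [ae_restrict_of_ae h1, ae_restrict_mem measurableSet_Ioi] with t ht ht0
    have ht0' : (0 : ℝ) < t := ht0
    congr 1
    rcases lt_or_gt_of_ne ht with h | h
    · rw [Set.indicator_of_mem (show t ∈ Set.Ioc (0 : ℝ) 1 from ⟨ht0', h.le⟩), fractTail,
        Set.indicator_of_notMem (by simpa using h.le), Int.fract_eq_self.2 ⟨ht0'.le, h⟩]
      simp
    · rw [Set.indicator_of_notMem (fun h' => absurd h'.2 (not_le.2 h)), fractTail,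
        Set.indicator_of_mem (show t ∈ Set.Ioi (1 : ℝ) from h)]
      simp
  constructor
  · exact hadd.1.congr hae
  · rw [mellin, ← integral_congr_ae hae]
    change mellin _ _ = _
    rw [hadd.2, h1.2]
    have h := riemannZeta₁_eq_mellin_fractTail hs0
    rw [riemannZeta_eq_inv_sub_mul (sub_ne_zero.1 hs'), h]
    have : -s + 1 ≠ 0 := by intro h; apply hs'; linear_combination -h
    field_simp
    ring

/-! ### The Müntz formula -/

/-- `φ` is differentiable on `(0, ∞)` with derivative `φ'`, where `φ` is both `O(u^{-a})` and
`O(u^{-b})` on the whole half-line, and `φ'` is both `O(u^{-a-1})` and `O(u^{-b-1})`. For `a < b`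
the first bound is effective near `0` and the second one near `∞`, so that the Mellin transform of
`φ` converges absolutely in the strip `a < Re s < b`. -/
structure MuntzData (φ φ' : ℝ → ℝ) (a b C : ℝ) : Prop where
  deriv : ∀ u, 0 < u → HasDerivAt φ (φ' u) u
  le_left : ∀ u, 0 < u → |φ u| ≤ C * u ^ (-a)
  le_right : ∀ u, 0 < u → |φ u| ≤ C * u ^ (-b)
  deriv_le_left : ∀ u, 0 < u → |φ' u| ≤ C * u ^ (-(a + 1))
  deriv_le_right : ∀ u, 0 < u → |φ' u| ≤ C * u ^ (-(b + 1))

/-- The Müntz operator `x ↦ ∫_0^∞ {u / x} φ'(u) du`, written in terms of the derivative `φ'`. -/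
def muntz (φ' : ℝ → ℝ) (x : ℝ) : ℝ := ∫ u in Set.Ioi (0 : ℝ), Int.fract (u / x) * φ' u

lemma integrableOn_rpow_mul_of_bounds {g : ℝ → ℝ} {a b C s : ℝ}
    (hg : AEStronglyMeasurable g (volume.restrict (Set.Ioi 0)))
    (h1 : ∀ u, 0 < u → |g u| ≤ C * u ^ (-a)) (h2 : ∀ u, 0 < u → |g u| ≤ C * u ^ (-b))
    (ha : a < s) (hb : s < b) :
    IntegrableOn (fun u => u ^ (s - 1) * g u) (Set.Ioi 0) := by
  have hm : AEStronglyMeasurable (fun u : ℝ => u ^ (s - 1) * g u) (volume.restrict (Set.Ioi 0)) :=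
    (measurable_id.pow_const _).aestronglyMeasurable.mul hg
  have key : ∀ (u : ℝ) (e : ℝ), 0 < u → |g u| ≤ C * u ^ (-e) →
      ‖u ^ (s - 1) * g u‖ ≤ C * u ^ (s - 1 - e) := by
    intro u e hu h
    rw [norm_mul, Real.norm_of_nonneg (Real.rpow_nonneg hu.le _), Real.norm_eq_abs,
      sub_eq_add_neg (s - 1) e, Real.rpow_add hu]
    calc u ^ (s - 1) * |g u| ≤ u ^ (s - 1) * (C * u ^ (-e)) := by gcongr
      _ = _ := by ring
  rw [← Set.Ioc_union_Ioi_eq_Ioi (zero_le_one' ℝ)]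
  refine IntegrableOn.union ?_ ?_
  · have hi : IntegrableOn (fun u : ℝ => C * u ^ (s - 1 - a)) (Set.Ioc 0 1) := by
      have := (intervalIntegral.intervalIntegrable_rpow' (a := 0) (b := 1) (r := s - 1 - a)
        (by linarith)).const_mul C
      rwa [intervalIntegrable_iff_integrableOn_Ioc_of_le zero_le_one] at this
    refine Integrable.mono' hi (hm.mono_set Set.Ioc_subset_Ioi_self) ?_
    filter_upwards [ae_restrict_mem measurableSet_Ioc] with u hu
    exact key u a hu.1 (h1 u hu.1)
  · have hi : IntegrableOn (fun u : ℝ => C * u ^ (s - 1 - b)) (Set.Ioi 1) :=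
      (integrableOn_Ioi_rpow_of_lt (by linarith) one_pos).const_mul C
    refine Integrable.mono' hi (hm.mono_set (Set.Ioi_subset_Ioi zero_le_one)) ?_
    filter_upwards [ae_restrict_mem measurableSet_Ioi] with u hu
    have hu' : (0 : ℝ) < u := one_pos.trans hu
    exact key u b hu' (h2 u hu')

lemma fract_le_rpow {v τ : ℝ} (hv : 0 < v) (h0 : 0 ≤ τ) (h1 : τ ≤ 1) : Int.fract v ≤ v ^ τ := by
  rcases le_or_gt 1 v with h | h
  · exact (Int.fract_lt_one v).le.trans (Real.one_le_rpow h h0)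
  · rw [Int.fract_eq_self.2 ⟨hv.le, h⟩]
    simpa using Real.rpow_le_rpow_of_exponent_ge hv h.le h1

namespace MuntzData

variable {φ φ' : ℝ → ℝ} {a b C : ℝ}

lemma aestronglyMeasurable (h : MuntzData φ φ' a b C) :
    AEStronglyMeasurable φ (volume.restrict (Set.Ioi 0)) :=
  ContinuousOn.aestronglyMeasurable
    (fun u hu => (h.deriv u hu).continuousAt.continuousWithinAt) measurableSet_Ioi

lemma aestronglyMeasurable_deriv (h : MuntzData φ φ' a b C) :
    AEStronglyMeasurable φ' (volume.restrict (Set.Ioi 0)) := by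
  refine (measurable_deriv φ).aestronglyMeasurable.congr ?_
  filter_upwards [ae_restrict_mem measurableSet_Ioi] with u hu
  exact (h.deriv u hu).deriv

lemma integrableOn_rpow_mul (h : MuntzData φ φ' a b C) {s : ℝ} (ha : a < s) (hb : s < b) :
    IntegrableOn (fun u => u ^ (s - 1) * φ u) (Set.Ioi 0) :=
  integrableOn_rpow_mul_of_bounds h.aestronglyMeasurable h.le_left h.le_right ha hb

lemma integrableOn_rpow_mul_deriv (h : MuntzData φ φ' a b C) {s : ℝ} (ha : a < s) (hb : s < b) :
    IntegrableOn (fun u => u ^ s * φ' u) (Set.Ioi 0) := by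
  have := integrableOn_rpow_mul_of_bounds h.aestronglyMeasurable_deriv h.deriv_le_left
    h.deriv_le_right (s := s + 1) (by linarith) (by linarith)
  simpa using this

lemma tendsto_zero (h : MuntzData φ φ' a b C) {s : ℝ} (ha : a < s) :
    Tendsto (fun u => u ^ s * φ u) (𝓝[>] 0) (𝓝 0) := by
  have h0 : Tendsto (fun u : ℝ => C * u ^ (s - a)) (𝓝[>] 0) (𝓝 0) := by
    have := ((Real.continuousAt_rpow_const 0 (s - a) (Or.inr (by linarith))).tendsto).const_mul C
    rw [Real.zero_rpow (by linarith), mul_zero] at this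
    exact this.mono_left nhdsWithin_le_nhds
  refine squeeze_zero_norm' ?_ h0
  filter_upwards [self_mem_nhdsWithin] with u (hu : 0 < u)
  rw [norm_mul, Real.norm_of_nonneg (Real.rpow_nonneg hu.le _), Real.norm_eq_abs,
      sub_eq_add_neg s a, Real.rpow_add hu]
  calc u ^ s * |φ u| ≤ u ^ s * (C * u ^ (-a)) := by gcongr; exact h.le_left u hu
      _ = _ := by ring

lemma tendsto_atTop (h : MuntzData φ φ' a b C) {s : ℝ} (hb : s < b) :
    Tendsto (fun u => u ^ s * φ u) atTop (𝓝 0) := by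
  have h0 : Tendsto (fun u : ℝ => C * u ^ (-(b - s))) atTop (𝓝 0) := by
    simpa using (tendsto_rpow_neg_atTop (show 0 < b - s by linarith)).const_mul C
  refine squeeze_zero_norm' ?_ h0
  filter_upwards [eventually_gt_atTop 0] with u hu
  rw [norm_mul, Real.norm_of_nonneg (Real.rpow_nonneg hu.le _), Real.norm_eq_abs,
      show -(b - s) = s + -b by ring, Real.rpow_add hu]
  calc u ^ s * |φ u| ≤ u ^ s * (C * u ^ (-b)) := by gcongr; exact h.le_right u hu
      _ = _ := by ring

lemma norm_fract_mul_deriv_le {τ x u : ℝ} (h0 : 0 ≤ τ) (h1 : τ ≤ 1)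
    (hx : 0 < x) (hu : 0 < u) :
    ‖Int.fract (u / x) * φ' u‖ ≤ x ^ (-τ) * ‖u ^ τ * φ' u‖ := by
  rw [norm_mul, norm_mul, Real.norm_of_nonneg (Int.fract_nonneg _),
    Real.norm_of_nonneg (Real.rpow_nonneg hu.le _), ← mul_assoc]
  gcongr
  calc Int.fract (u / x) ≤ (u / x) ^ τ := fract_le_rpow (by positivity) h0 h1
    _ = x ^ (-τ) * u ^ τ := by
      rw [Real.div_rpow hu.le hx.le, Real.rpow_neg hx.le]; field_simp

lemma integrableOn_fract_mul_deriv (h : MuntzData φ φ' a b C) {τ x : ℝ} (h0 : 0 ≤ τ) (h1 : τ ≤ 1)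
    (ha : a < τ) (hb : τ < b) (hx : 0 < x) :
    IntegrableOn (fun u => Int.fract (u / x) * φ' u) (Set.Ioi 0) := by
  refine Integrable.mono' ((h.integrableOn_rpow_mul_deriv ha hb).norm.const_mul (x ^ (-τ)))
    ((measurable_fract.comp (measurable_id.div_const x)).aestronglyMeasurable.mul
      h.aestronglyMeasurable_deriv) ?_
  filter_upwards [ae_restrict_mem measurableSet_Ioi] with u hu
  exact norm_fract_mul_deriv_le h0 h1 hx hu

/-- `|∫ {u / x} φ'(u) du| = O(x^{-τ})` for every `τ ∈ [0, 1]` in the strip, since `{v} ≤ v^τ`. -/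
lemma abs_muntz_le (h : MuntzData φ φ' a b C) {τ : ℝ} (h0 : 0 ≤ τ) (h1 : τ ≤ 1)
    (ha : a < τ) (hb : τ < b) :
    ∃ K : ℝ, 0 ≤ K ∧ ∀ x, 0 < x → |muntz φ' x| ≤ K * x ^ (-τ) := by
  refine ⟨∫ u in Set.Ioi (0 : ℝ), ‖u ^ τ * φ' u‖, by positivity, fun x hx => ?_⟩
  rw [← Real.norm_eq_abs, muntz, mul_comm, ← integral_const_mul]
  refine (norm_integral_le_integral_norm _).trans ?_
  refine setIntegral_mono_on (h.integrableOn_fract_mul_deriv h0 h1 ha hb hx).norm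
    ((h.integrableOn_rpow_mul_deriv ha hb).norm.const_mul _) measurableSet_Ioi (fun u hu => ?_)
  exact norm_fract_mul_deriv_le h0 h1 hx hu

/-- On `(m x, (m + 1) x)` the integrand `{u / x} φ'(u) + φ(u) / x` is the derivative of
`(u / x - m) φ(u)`. -/
lemma integral_Ioc_fract (h : MuntzData φ φ' a b C) (ha : a < 1) {x : ℝ} (hx : 0 < x)
    (hi : IntegrableOn (fun u => Int.fract (u / x) * φ' u + x⁻¹ * φ u) (Set.Ioi 0)) (m : ℕ) :
    ∫ u in Set.Ioc (m * x) ((m + 1 : ℕ) * x), (Int.fract (u / x) * φ' u + x⁻¹ * φ u) =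
      φ ((m + 1 : ℕ) * x) := by
  have hm0 : 0 ≤ m * x := by positivity
  have hlt : m * x < (m + 1 : ℕ) * x := by push_cast; nlinarith
  rw [← intervalIntegral.integral_of_le hlt.le]
  have hint : IntervalIntegrable (fun u => Int.fract (u / x) * φ' u + x⁻¹ * φ u) volume
      (m * x) ((m + 1 : ℕ) * x) := by
    rw [intervalIntegrable_iff_integrableOn_Ioc_of_le hlt.le]
    exact hi.mono_set (fun u hu => lt_of_le_of_lt hm0 hu.1)
  have hd : ∀ u, 0 < u → HasDerivAt (fun u => (u / x - m) * φ u)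
      ((u / x - m) * φ' u + x⁻¹ * φ u) u := by
    intro u hu
    have h1 : HasDerivAt (fun u : ℝ => u / x - m) x⁻¹ u := by
      simpa using ((hasDerivAt_id u).div_const x).sub_const (m : ℝ)
    exact (h1.mul (h.deriv u hu)).congr_deriv (add_comm _ _)
  have hfr : ∀ u ∈ Set.Ioo (m * x) ((m + 1 : ℕ) * x), Int.fract (u / x) = u / x - m := by
    intro u hu
    rw [Int.fract_eq_iff]
    refine ⟨?_, ?_, m, by simp⟩
    · rw [sub_nonneg, le_div_iff₀ hx]; exact hu.1.le
    · rw [sub_lt_iff_lt_add, div_lt_iff₀ hx]; have := hu.2; push_cast at this; linarith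
  have hleft : Tendsto (fun u => (u / x - m) * φ u) (𝓝[>] (m * x)) (𝓝 0) := by
    rcases Nat.eq_zero_or_pos m with rfl | hm
    · have := (h.tendsto_zero ha).const_mul x⁻¹
      simp only [Nat.cast_zero, zero_mul, mul_zero] at this ⊢
      refine this.congr (fun u => ?_)
      rw [Real.rpow_one]; ring
    · have hpos : 0 < m * x := by positivity
      have := (hd _ hpos).continuousAt.tendsto
      rw [mul_div_cancel_right₀ _ hx.ne', sub_self, zero_mul] at this
      exact this.mono_left nhdsWithin_le_nhds
  have hright : Tendsto (fun u => (u / x - m) * φ u) (𝓝[<] ((m + 1 : ℕ) * x))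
      (𝓝 (φ ((m + 1 : ℕ) * x))) := by
    have := (hd _ (hm0.trans_lt hlt)).continuousAt.tendsto
    rw [mul_div_cancel_right₀ _ hx.ne', Nat.cast_add, Nat.cast_one, add_sub_cancel_left,
      one_mul] at this
    rw [Nat.cast_add, Nat.cast_one]
    exact this.mono_left nhdsWithin_le_nhds
  rw [intervalIntegral.integral_eq_sub_of_hasDerivAt_of_tendsto hlt (fun u hu => ?_) hint hleft
    hright, sub_zero]
  rw [hfr u hu]
  exact hd u (hm0.trans_lt hu.1)

lemma integrableOn (h : MuntzData φ φ' a b C) (ha : a < 1) (hb : 1 < b) :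
    IntegrableOn φ (Set.Ioi 0) := by
  simpa using h.integrableOn_rpow_mul ha hb

/-- First-order Euler–Maclaurin summation:
`∑_{m ≥ 1} φ(m x) = x⁻¹ ∫ φ + ∫ {u / x} φ'(u) du`. -/
theorem hasSum (h : MuntzData φ φ' a b C) (ha : a < 1) (hb : 1 < b) {x : ℝ} (hx : 0 < x) :
    HasSum (fun m : ℕ => φ ((m + 1 : ℕ) * x))
      (x⁻¹ * (∫ u in Set.Ioi (0 : ℝ), φ u) + muntz φ' x) := by
  have h1 := h.integrableOn_fract_mul_deriv zero_le_one le_rfl ha hb hx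
  have h2 : IntegrableOn (fun u => x⁻¹ * φ u) (Set.Ioi 0) := (h.integrableOn ha hb).const_mul _
  have hi : IntegrableOn (fun u => Int.fract (u / x) * φ' u + x⁻¹ * φ u) (Set.Ioi 0) := h1.add h2
  have hmono : StrictMono (fun m : ℕ => (m : ℝ) * x) := fun m n hmn => by
    have : (m : ℝ) < n := by exact_mod_cast hmn
    dsimp only; nlinarith
  have hU : (⋃ m : ℕ, Set.Ioc ((m : ℝ) * x) ((m + 1 : ℕ) * x)) = Set.Ioi 0 := by
    ext u
    simp only [Set.mem_iUnion, Set.mem_Ioc, Set.mem_Ioi]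
    constructor
    · rintro ⟨m, hm, -⟩
      exact lt_of_le_of_lt (by positivity) hm
    · intro hu
      have hux : 0 < u / x := by positivity
      obtain ⟨m, hm⟩ : ∃ m, ⌈u / x⌉₊ = m + 1 :=
        Nat.exists_eq_succ_of_ne_zero (Nat.ceil_pos.2 hux).ne'
      refine ⟨m, ?_, ?_⟩
      · rw [← lt_div_iff₀ hx]; exact Nat.lt_ceil.1 (by omega)
      · rw [← div_le_iff₀ hx]; exact Nat.ceil_le.1 hm.le
  have hS := hasSum_integral_iUnion (μ := volume)
    (f := fun u => Int.fract (u / x) * φ' u + x⁻¹ * φ u)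
    (s := fun m : ℕ => Set.Ioc ((m : ℝ) * x) ((m + 1 : ℕ) * x)) (fun _ => measurableSet_Ioc)
    hmono.monotone.pairwise_disjoint_on_Ioc_succ (by rw [hU]; exact hi)
  rw [hU, integral_add h1 h2, integral_const_mul, add_comm] at hS
  simp_rw [h.integral_Ioc_fract ha hx hi] at hS
  exact hS

end MuntzData

/-- The Mellin transform of a rescaled sawtooth. -/
lemma hasMellin_fract_div {s : ℂ} (hs0 : 0 < s.re) (hs1 : s.re < 1) {u : ℝ} (hu : 0 < u) :
    HasMellin (fun x : ℝ => ((Int.fract (u / x) : ℝ) : ℂ)) s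
      ((u : ℂ) ^ s * (-riemannZeta s / s)) := by
  have h := hasMellin_fract_neg hs0 hs1
  have hg1 : MellinConvergent (fun x : ℝ => ((Int.fract (x⁻¹) : ℝ) : ℂ)) s := by
    have := (MellinConvergent.comp_rpow (f := fun x : ℝ => ((Int.fract x : ℝ) : ℂ)) (s := s)
      (a := -1) (by norm_num)).2 (by simpa [div_neg] using h.1)
    simpa only [Real.rpow_neg_one] using this
  have hfun : (fun x : ℝ => ((Int.fract (u / x) : ℝ) : ℂ)) =
      fun x => (fun x : ℝ => ((Int.fract (x⁻¹) : ℝ) : ℂ)) (u⁻¹ * x) := by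
    ext x; simp [div_eq_mul_inv, mul_comm]
  constructor
  · rw [hfun]
    exact (MellinConvergent.comp_mul_left (inv_pos.2 hu)).2 hg1
  · rw [hfun, mellin_comp_mul_left (fun x : ℝ => ((Int.fract (x⁻¹) : ℝ) : ℂ)) _ (inv_pos.2 hu),
      mellin_comp_inv (fun x : ℝ => ((Int.fract x : ℝ) : ℂ)), h.2, smul_eq_mul, Complex.ofReal_inv,
      Complex.inv_cpow _ _ (by rw [Complex.arg_ofReal_of_nonneg hu.le]; exact Real.pi_ne_zero.symm),
      Complex.cpow_neg, inv_inv]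

/-- The norms `x^{σ-1} {u / x}` have an integral proportional to `u^σ`. -/
lemma exists_integral_norm_cpow_mul_fract {s : ℂ} (hs0 : 0 < s.re) (hs1 : s.re < 1) :
    ∃ c : ℝ, ∀ u : ℝ, 0 < u →
      ∫ x in Set.Ioi (0 : ℝ), ‖(x : ℂ) ^ (s - 1) * ((Int.fract (u / x) : ℝ) : ℂ)‖ =
        u ^ s.re * c := by
  refine ⟨(-riemannZeta (s.re : ℂ) / (s.re : ℂ)).re, fun u hu => ?_⟩
  have h := (hasMellin_fract_div (s := (s.re : ℂ)) (by simpa) (by simpa) hu).2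
  have h1 : mellin (fun x : ℝ => ((Int.fract (u / x) : ℝ) : ℂ)) (s.re : ℂ) =
      ((∫ x in Set.Ioi (0 : ℝ), ‖(x : ℂ) ^ (s - 1) * ((Int.fract (u / x) : ℝ) : ℂ)‖ : ℝ) : ℂ) := by
    rw [mellin, ← integral_complex_ofReal]
    refine setIntegral_congr_fun measurableSet_Ioi (fun x (hx : 0 < x) => ?_)
    rw [norm_mul, Complex.norm_cpow_eq_rpow_re_of_pos hx, Complex.norm_real,
      Real.norm_of_nonneg (Int.fract_nonneg _), smul_eq_mul, Complex.ofReal_mul,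
      Complex.ofReal_cpow hx.le]
    simp
  rw [h1, ← Complex.ofReal_cpow hu.le] at h
  have := congrArg Complex.re h
  rwa [Complex.ofReal_re, Complex.re_ofReal_mul] at this

namespace MuntzData

variable {φ φ' : ℝ → ℝ} {a b C : ℝ}

lemma mellinConvergent (h : MuntzData φ φ' a b C) {s : ℂ} (ha : a < s.re) (hb : s.re < b) :
    MellinConvergent (fun u => (φ u : ℂ)) s := by
  have hm : AEStronglyMeasurable (fun u : ℝ => (u : ℂ) ^ (s - 1) • (φ u : ℂ))
      (volume.restrict (Set.Ioi 0)) :=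
    (Complex.measurable_ofReal.pow_const _).aestronglyMeasurable.smul
      (Complex.continuous_ofReal.comp_aestronglyMeasurable h.aestronglyMeasurable)
  refine Integrable.mono' (h.integrableOn_rpow_mul ha hb).norm hm ?_
  filter_upwards [ae_restrict_mem measurableSet_Ioi] with u hu
  rw [norm_smul, norm_mul, Complex.norm_cpow_eq_rpow_re_of_pos hu, Complex.norm_real,
    Real.norm_of_nonneg (Real.rpow_nonneg (le_of_lt hu) _)]
  simp

lemma integrableOn_cpow_mul_deriv (h : MuntzData φ φ' a b C) {s : ℂ}
    (ha : a < s.re) (hb : s.re < b) :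
    IntegrableOn (fun u : ℝ => (u : ℂ) ^ s * (φ' u : ℂ)) (Set.Ioi 0) := by
  have hm : AEStronglyMeasurable (fun u : ℝ => (u : ℂ) ^ s * (φ' u : ℂ))
      (volume.restrict (Set.Ioi 0)) :=
    (Complex.measurable_ofReal.pow_const _).aestronglyMeasurable.mul
      (Complex.continuous_ofReal.comp_aestronglyMeasurable h.aestronglyMeasurable_deriv)
  refine Integrable.mono' (h.integrableOn_rpow_mul_deriv ha hb).norm hm ?_
  filter_upwards [ae_restrict_mem measurableSet_Ioi] with u hu
  rw [norm_mul, norm_mul, Complex.norm_cpow_eq_rpow_re_of_pos hu, Complex.norm_real,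
    Real.norm_of_nonneg (Real.rpow_nonneg (le_of_lt hu) _)]

/-- Integration by parts for the Mellin transform. -/
lemma integral_cpow_mul_deriv (h : MuntzData φ φ' a b C) {s : ℂ}
    (ha : a < s.re) (hb : s.re < b) (hs : s ≠ 0) :
    ∫ u in Set.Ioi (0 : ℝ), (u : ℂ) ^ s * (φ' u : ℂ) = -s * mellin (fun u => (φ u : ℂ)) s := by
  have hnorm : ∀ u : ℝ, 0 < u → ‖(u : ℂ) ^ s * (φ u : ℂ)‖ = ‖u ^ s.re * φ u‖ := by
    intro u hu
    rw [norm_mul, norm_mul, Complex.norm_cpow_eq_rpow_re_of_pos hu, Complex.norm_real,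
      Real.norm_of_nonneg (Real.rpow_nonneg (le_of_lt hu) _)]
  have hmell := (h.mellinConvergent ha hb).const_smul s
  have h1 := integral_Ioi_mul_deriv_eq_deriv_mul (a := (0 : ℝ)) (a' := (0 : ℂ)) (b' := (0 : ℂ))
    (u := fun u : ℝ => (u : ℂ) ^ s) (v := fun u : ℝ => (φ u : ℂ))
    (u' := fun u : ℝ => s * (u : ℂ) ^ (s - 1)) (v' := fun u : ℝ => (φ' u : ℂ))
    (fun u hu => hasDerivAt_ofReal_cpow_const (ne_of_gt hu) hs)
    (fun u hu => (h.deriv u hu).ofReal_comp)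
    (h.integrableOn_cpow_mul_deriv ha hb)
    (by
      refine IntegrableOn.congr_fun hmell (fun u _ => ?_) measurableSet_Ioi
      simp only [Pi.mul_apply, smul_eq_mul]; ring)
    (by
      rw [tendsto_zero_iff_norm_tendsto_zero]
      refine (tendsto_zero_iff_norm_tendsto_zero.1 (h.tendsto_zero ha)).congr' ?_
      filter_upwards [self_mem_nhdsWithin] with u hu
      exact (hnorm u hu).symm)
    (by
      rw [tendsto_zero_iff_norm_tendsto_zero]
      refine (tendsto_zero_iff_norm_tendsto_zero.1 (h.tendsto_atTop hb)).congr' ?_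
      filter_upwards [eventually_gt_atTop 0] with u hu
      exact (hnorm u hu).symm)
  rw [h1, mellin, ← integral_const_mul, sub_zero, zero_sub, ← integral_neg]
  refine integral_congr_ae (Eventually.of_forall fun u => ?_)
  simp only [smul_eq_mul]; ring

lemma integrable_prod_kernel (h : MuntzData φ φ' a b C) {s : ℂ}
    (ha : a < s.re) (hb : s.re < b) (hs0 : 0 < s.re) (hs1 : s.re < 1) :
    Integrable (Function.uncurry fun x u : ℝ =>
      (x : ℂ) ^ (s - 1) * ((Int.fract (u / x) : ℝ) : ℂ) * (φ' u : ℂ))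
      ((volume.restrict (Set.Ioi 0)).prod (volume.restrict (Set.Ioi 0))) := by
  have hm : AEStronglyMeasurable (Function.uncurry fun x u : ℝ =>
      (x : ℂ) ^ (s - 1) * ((Int.fract (u / x) : ℝ) : ℂ) * (φ' u : ℂ))
      ((volume.restrict (Set.Ioi 0)).prod (volume.restrict (Set.Ioi 0))) := by
    refine AEStronglyMeasurable.mul (Measurable.aestronglyMeasurable ?_) ?_
    · refine Measurable.mul ?_ ?_
      · exact (Complex.measurable_ofReal.comp measurable_fst).pow_const _
      · exact Complex.measurable_ofReal.comp
          (measurable_fract.comp (measurable_snd.div measurable_fst))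
    · exact (Complex.continuous_ofReal.comp_aestronglyMeasurable
        h.aestronglyMeasurable_deriv).comp_snd
  rw [integrable_prod_iff' hm]
  obtain ⟨c, hc⟩ := exists_integral_norm_cpow_mul_fract hs0 hs1
  constructor
  · filter_upwards [ae_restrict_mem measurableSet_Ioi] with u hu
    have := (hasMellin_fract_div hs0 hs1 hu).1
    exact Integrable.mul_const this (φ' u : ℂ)
  · refine ((h.integrableOn_rpow_mul_deriv ha hb).norm.mul_const c).congr ?_
    filter_upwards [ae_restrict_mem measurableSet_Ioi] with u hu
    simp only [Function.uncurry_apply_pair]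
    simp_rw [norm_mul _ (φ' u : ℂ)]
    rw [integral_mul_const, hc u hu, norm_mul, Complex.norm_real,
      Real.norm_of_nonneg (Real.rpow_nonneg (le_of_lt hu) _)]
    ring

/-- **Müntz's formula**: in the strip `0 < Re s < 1` the Mellin transform of
`x ↦ ∑_{m ≥ 1} φ(m x) - x⁻¹ ∫ φ` is `ζ(s)` times that of `φ`. -/
theorem hasMellin_muntz (h : MuntzData φ φ' a b C) {s : ℂ}
    (ha : a < s.re) (hb : s.re < b) (hs0 : 0 < s.re) (hs1 : s.re < 1) :
    HasMellin (fun x => (muntz φ' x : ℂ)) s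
      (riemannZeta s * mellin (fun u => (φ u : ℂ)) s) := by
  have hs : s ≠ 0 := by rintro rfl; simp at hs0
  have hprod := h.integrable_prod_kernel ha hb hs0 hs1
  have hinner : ∀ x : ℝ, ∫ u in Set.Ioi (0 : ℝ),
      (x : ℂ) ^ (s - 1) * ((Int.fract (u / x) : ℝ) : ℂ) * (φ' u : ℂ) =
      (x : ℂ) ^ (s - 1) • (muntz φ' x : ℂ) := by
    intro x
    simp_rw [mul_assoc]
    rw [integral_const_mul, muntz, ← integral_complex_ofReal, smul_eq_mul]
    simp
  constructor
  · have := hprod.integral_prod_left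
    simp only [Function.uncurry_apply_pair, hinner] at this
    exact this
  · rw [mellin]
    simp_rw [← hinner]
    rw [integral_integral_swap hprod]
    have h2 : ∫ u in Set.Ioi (0 : ℝ), ∫ x in Set.Ioi (0 : ℝ),
        (x : ℂ) ^ (s - 1) * ((Int.fract (u / x) : ℝ) : ℂ) * (φ' u : ℂ) =
        ∫ u in Set.Ioi (0 : ℝ), (-riemannZeta s / s) * ((u : ℂ) ^ s * (φ' u : ℂ)) := by
      refine setIntegral_congr_fun measurableSet_Ioi (fun u hu => ?_)
      have := (hasMellin_fract_div hs0 hs1 hu).2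
      rw [mellin] at this
      simp only [smul_eq_mul] at this
      rw [integral_mul_const, this]
      ring
    rw [h2, integral_const_mul, h.integral_cpow_mul_deriv ha hb hs]
    field_simp

end MuntzData

/-! ### The kernel `k` and its Mellin transform -/

lemma rpow_mul_exp_neg_le {q r : ℝ} (h : 0 ≤ q + r) :
    ∃ C : ℝ, 0 ≤ C ∧ ∀ u : ℝ, 0 < u → u ^ q * Real.exp (-u) ≤ C * u ^ (-r) := by
  obtain ⟨C, hC0, hC⟩ : ∃ C : ℝ, 0 ≤ C ∧ ∀ u : ℝ, 0 < u → u ^ (q + r) ≤ C * Real.exp u := by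
    rcases h.eq_or_lt with h0 | h0
    · refine ⟨1, zero_le_one, fun u hu => ?_⟩
      rw [← h0, Real.rpow_zero, one_mul]
      exact Real.one_le_exp hu.le
    · refine ⟨(q + r) ^ (q + r), by positivity, fun u hu => ?_⟩
      have h1 : u / (q + r) ≤ Real.exp (u / (q + r)) := by
        linarith [Real.add_one_le_exp (u / (q + r))]
      have h2 := Real.rpow_le_rpow (by positivity) h1 h0.le
      rw [← Real.exp_mul, div_mul_cancel₀ _ h0.ne', Real.div_rpow hu.le h0.le,
        div_le_iff₀ (by positivity)] at h2
      linarith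
  refine ⟨C, hC0, fun u hu => ?_⟩
  have h3 : u ^ q = u ^ (q + r) * u ^ (-r) := by rw [← Real.rpow_add hu]; ring_nf
  calc u ^ q * Real.exp (-u) = u ^ (q + r) * Real.exp (-u) * u ^ (-r) := by rw [h3]; ring
    _ ≤ (C * Real.exp u) * Real.exp (-u) * u ^ (-r) := by gcongr; exact hC u hu
    _ = C * u ^ (-r) * (Real.exp u * Real.exp (-u)) := by ring
    _ = C * u ^ (-r) := by rw [← Real.exp_add]; simp

/-- The function `u ↦ u^p e^{-u}`. -/
def rpowExp (p u : ℝ) : ℝ := u ^ p * Real.exp (-u)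

/-- The derivative of `u ↦ u^p e^{-u}`. -/
def rpowExpDeriv (p u : ℝ) : ℝ := p * (u ^ (p - 1) * Real.exp (-u)) - u ^ p * Real.exp (-u)

/-- The strip `-1/2 < Re s < 2` is far from the largest possible one, but contains `[0, 1]`. -/
lemma muntzData_rpowExp {p : ℝ} (hp : 1 / 2 ≤ p) :
    ∃ C, MuntzData (rpowExp p) (rpowExpDeriv p) (-(1 / 2)) 2 C := by
  obtain ⟨C1, h1, H1⟩ := rpow_mul_exp_neg_le (q := p) (r := -(1 / 2)) (by linarith)
  obtain ⟨C2, h2, H2⟩ := rpow_mul_exp_neg_le (q := p) (r := 2) (by linarith)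
  obtain ⟨C3, h3, H3⟩ := rpow_mul_exp_neg_le (q := p - 1) (r := -(1 / 2) + 1) (by linarith)
  obtain ⟨C4, h4, H4⟩ := rpow_mul_exp_neg_le (q := p) (r := -(1 / 2) + 1) (by linarith)
  obtain ⟨C5, h5, H5⟩ := rpow_mul_exp_neg_le (q := p - 1) (r := 2 + 1) (by linarith)
  obtain ⟨C6, h6, H6⟩ := rpow_mul_exp_neg_le (q := p) (r := 2 + 1) (by linarith)
  have hp0 : 0 ≤ p := by linarith
  have hpC3 : 0 ≤ p * C3 := by positivity
  have hpC5 : 0 ≤ p * C5 := by positivity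
  have habs : ∀ u, 0 < u → |rpowExpDeriv p u| ≤
      p * (u ^ (p - 1) * Real.exp (-u)) + u ^ p * Real.exp (-u) := by
    intro u hu
    have e1 : 0 ≤ p * (u ^ (p - 1) * Real.exp (-u)) := by positivity
    have e2 : 0 ≤ u ^ p * Real.exp (-u) := by positivity
    rw [rpowExpDeriv, abs_le]; constructor <;> linarith
  refine ⟨C1 + C2 + p * C3 + C4 + p * C5 + C6, ⟨fun u hu => ?_, fun u hu => ?_, fun u hu => ?_,
    fun u hu => ?_, fun u hu => ?_⟩⟩
  · have := (Real.hasDerivAt_rpow_const (x := u) (p := p) (Or.inl hu.ne')).mul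
      ((hasDerivAt_id u).neg.exp)
    refine this.congr_deriv ?_
    simp only [rpowExpDeriv, Pi.neg_apply, id]; ring
  · rw [rpowExp, abs_of_nonneg (by positivity)]
    refine (H1 u hu).trans ?_
    gcongr; linarith
  · rw [rpowExp, abs_of_nonneg (by positivity)]
    refine (H2 u hu).trans ?_
    gcongr; linarith
  · refine (habs u hu).trans ?_
    have e := mul_le_mul_of_nonneg_left (H3 u hu) hp0
    have e' := H4 u hu
    calc _ ≤ (p * C3 + C4) * u ^ (-(-(1 / 2) + 1) : ℝ) := by linarith
      _ ≤ _ := mul_le_mul_of_nonneg_right (by linarith) (by positivity)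
  · refine (habs u hu).trans ?_
    have e := mul_le_mul_of_nonneg_left (H5 u hu) hp0
    have e' := H6 u hu
    calc _ ≤ (p * C5 + C6) * u ^ (-(2 + 1) : ℝ) := by linarith
      _ ≤ _ := mul_le_mul_of_nonneg_right (by linarith) (by positivity)

lemma integral_rpowExp {p : ℝ} (hp : 0 < p + 1) :
    ∫ u in Set.Ioi (0 : ℝ), rpowExp p u = Real.Gamma (p + 1) := by
  rw [Real.Gamma_eq_integral hp]
  refine setIntegral_congr_fun measurableSet_Ioi (fun u _ => ?_)
  simp only [rpowExp, add_sub_cancel_right]; ring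

lemma mellin_rpowExp {p : ℝ} {s : ℂ} (hs : 0 < s.re + p) :
    mellin (fun u => (rpowExp p u : ℂ)) s = Complex.Gamma (s + p) := by
  rw [Complex.Gamma_eq_integral (by simpa using hs), Complex.GammaIntegral_eq_mellin,
    ← mellin_cpow_smul]
  refine setIntegral_congr_fun measurableSet_Ioi (fun u (hu : 0 < u) => ?_)
  simp only [rpowExp, smul_eq_mul, Complex.ofReal_mul, Complex.ofReal_cpow hu.le]

/-- The Dirichlet-type series `∑_{d ≥ 1} d^p e^{-d x}`. -/
def powExpSum (p x : ℝ) : ℝ := ∑' d : ℕ, ((d + 1 : ℕ) : ℝ) ^ p * Real.exp (-((d + 1 : ℕ) * x))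

lemma hasSum_powExpSum {p : ℝ} (hp : 1 / 2 ≤ p) {x : ℝ} (hx : 0 < x) :
    HasSum (fun d : ℕ => ((d + 1 : ℕ) : ℝ) ^ p * Real.exp (-((d + 1 : ℕ) * x)))
      (Real.Gamma (p + 1) * x ^ (-(p + 1)) + x ^ (-p) * muntz (rpowExpDeriv p) x) := by
  obtain ⟨C, h⟩ := muntzData_rpowExp hp
  have h1 := (h.hasSum (by norm_num) (by norm_num) hx).mul_left (x ^ (-p))
  rw [integral_rpowExp (by linarith)] at h1
  have e1 : (fun d : ℕ => ((d + 1 : ℕ) : ℝ) ^ p * Real.exp (-((d + 1 : ℕ) * x))) =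
      fun d : ℕ => x ^ (-p) * rpowExp p ((d + 1 : ℕ) * x) := by
    funext d
    have hd : (0 : ℝ) ≤ ((d + 1 : ℕ) : ℝ) := by positivity
    rw [rpowExp, Real.mul_rpow hd hx.le, Real.rpow_neg hx.le]
    have := (Real.rpow_pos_of_pos hx p).ne'
    field_simp
  have e2 : Real.Gamma (p + 1) * x ^ (-(p + 1)) + x ^ (-p) * muntz (rpowExpDeriv p) x =
      x ^ (-p) * (x⁻¹ * Real.Gamma (p + 1) + muntz (rpowExpDeriv p) x) := by
    rw [mul_add, neg_add, Real.rpow_add hx, Real.rpow_neg_one]; ring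
  rw [e1, e2]
  exact h1

lemma powExpSum_eq {p : ℝ} (hp : 1 / 2 ≤ p) {x : ℝ} (hx : 0 < x) :
    powExpSum p x =
      Real.Gamma (p + 1) * x ^ (-(p + 1)) + x ^ (-p) * muntz (rpowExpDeriv p) x :=
  (hasSum_powExpSum hp hx).tsum_eq

lemma hasDerivAt_powExpSum {p : ℝ} (hp : 1 / 2 ≤ p) {x : ℝ} (hx : 0 < x) :
    HasDerivAt (powExpSum p) (-powExpSum (p + 1) x) x := by
  have hx2 : 0 < x / 2 := by positivity
  have h := hasDerivAt_tsum_of_isPreconnected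
    (g := fun (d : ℕ) (y : ℝ) => ((d + 1 : ℕ) : ℝ) ^ p * Real.exp (-((d + 1 : ℕ) * y)))
    (g' := fun (d : ℕ) (y : ℝ) => -(((d + 1 : ℕ) : ℝ) ^ (p + 1) * Real.exp (-((d + 1 : ℕ) * y))))
    (hasSum_powExpSum (p := p + 1) (by linarith) hx2).summable isOpen_Ioi
    (isPreconnected_Ioi (a := x / 2)) (fun d y _ => ?_) (fun d y hy => ?_)
    (show x ∈ Set.Ioi (x / 2) by simp [hx]) (hasSum_powExpSum hp hx).summable
    (show x ∈ Set.Ioi (x / 2) by simp [hx])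
  · rw [tsum_neg] at h
    exact h
  · have hd : (0 : ℝ) < ((d + 1 : ℕ) : ℝ) := by positivity
    have := ((((hasDerivAt_id y).const_mul ((d + 1 : ℕ) : ℝ)).fun_neg).exp).const_mul
      (((d + 1 : ℕ) : ℝ) ^ p)
    refine this.congr_deriv ?_
    rw [Real.rpow_add_one hd.ne']; simp only [id]; ring
  · have hy' : x / 2 < y := hy
    rw [norm_neg, Real.norm_of_nonneg (by positivity)]
    gcongr

/-- The function `φ(x) = ∑_{d ≥ 1} √d e^{-d x} - Γ(3/2) x^{-3/2}`. -/
def sqrtSum (x : ℝ) : ℝ := powExpSum (1 / 2) x - Real.Gamma (3 / 2) * x ^ (-(3 / 2) : ℝ)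

/-- The derivative of `sqrtSum`. -/
def sqrtSumDeriv (x : ℝ) : ℝ :=
  -powExpSum (3 / 2) x + Real.Gamma (5 / 2) * x ^ (-(5 / 2) : ℝ)

lemma sqrtSum_eq {x : ℝ} (hx : 0 < x) :
    sqrtSum x = x ^ (-(1 / 2) : ℝ) * muntz (rpowExpDeriv (1 / 2)) x := by
  rw [sqrtSum, powExpSum_eq le_rfl hx]; norm_num

lemma sqrtSumDeriv_eq {x : ℝ} (hx : 0 < x) :
    sqrtSumDeriv x = -(x ^ (-(3 / 2) : ℝ) * muntz (rpowExpDeriv (3 / 2)) x) := by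
  rw [sqrtSumDeriv, powExpSum_eq (by norm_num) hx]; norm_num

/-- Up to powers of `x`, both `φ` and `φ'` are themselves Müntz transforms of functions
`u^p e^{-u}`, so that the trivial bounds `O(1)` and `O(x⁻¹)` for the latter give the strip
`1/2 < Re s < 3/2`. -/
lemma muntzData_sqrtSum : ∃ C, MuntzData sqrtSum sqrtSumDeriv (1 / 2) (3 / 2) C := by
  obtain ⟨c1, h1⟩ := muntzData_rpowExp (p := 1 / 2) le_rfl
  obtain ⟨c2, h2⟩ := muntzData_rpowExp (p := 3 / 2) (by norm_num)
  obtain ⟨K1, k1, H1⟩ := h1.abs_muntz_le le_rfl zero_le_one (by norm_num) (by norm_num)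
  obtain ⟨K2, k2, H2⟩ := h1.abs_muntz_le zero_le_one le_rfl (by norm_num) (by norm_num)
  obtain ⟨K3, k3, H3⟩ := h2.abs_muntz_le le_rfl zero_le_one (by norm_num) (by norm_num)
  obtain ⟨K4, k4, H4⟩ := h2.abs_muntz_le zero_le_one le_rfl (by norm_num) (by norm_num)
  have key : ∀ (M K p e r u : ℝ), 0 < u → K ≤ K1 + K2 + K3 + K4 → |M| ≤ K * u ^ (-e) →
      r = p + e → |u ^ (-p) * M| ≤ (K1 + K2 + K3 + K4) * u ^ (-r) := by
    rintro M K p e r u hu hK hM rfl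
    rw [abs_mul, abs_of_nonneg (by positivity), neg_add, Real.rpow_add hu]
    calc u ^ (-p) * |M| ≤ u ^ (-p) * (K * u ^ (-e)) := by gcongr
      _ ≤ u ^ (-p) * ((K1 + K2 + K3 + K4) * u ^ (-e)) := by gcongr
      _ = _ := by ring
  refine ⟨K1 + K2 + K3 + K4, ⟨fun u hu => ?_, fun u hu => ?_, fun u hu => ?_,
    fun u hu => ?_, fun u hu => ?_⟩⟩
  · have e1 := hasDerivAt_powExpSum (p := 1 / 2) le_rfl hu
    have e2 := (Real.hasDerivAt_rpow_const (x := u) (p := -(3 / 2)) (Or.inl hu.ne')).const_mul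
      (Real.Gamma (3 / 2))
    refine (e1.sub e2).congr_deriv ?_
    have hG : Real.Gamma (5 / 2) = 3 / 2 * Real.Gamma (3 / 2) := by
      rw [← Real.Gamma_add_one (by norm_num)]; norm_num
    rw [sqrtSumDeriv, hG, show (-(3 / 2) - 1 : ℝ) = -(5 / 2) by norm_num,
      show (1 / 2 + 1 : ℝ) = 3 / 2 by norm_num]
    ring
  · rw [sqrtSum_eq hu]
    exact key _ K1 _ _ _ u hu (by linarith) (H1 u hu) (by norm_num)
  · rw [sqrtSum_eq hu]
    exact key _ K2 _ _ _ u hu (by linarith) (H2 u hu) (by norm_num)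
  · rw [sqrtSumDeriv_eq hu, abs_neg]
    exact key _ K3 _ _ _ u hu (by linarith) (H3 u hu) (by norm_num)
  · rw [sqrtSumDeriv_eq hu, abs_neg]
    exact key _ K4 _ _ _ u hu (by linarith) (H4 u hu) (by norm_num)

/-- Müntz's formula for `u^{1/2} e^{-u}`, shifted by `1/2`. -/
lemma mellin_sqrtSum {s : ℂ} (h1 : 1 / 2 < s.re) (h2 : s.re < 3 / 2) :
    mellin (fun u => (sqrtSum u : ℂ)) s = riemannZeta (s - 1 / 2) * Complex.Gamma s := by
  obtain ⟨C, h⟩ := muntzData_rpowExp (p := 1 / 2) le_rfl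
  have hre : (s - 1 / 2).re = s.re - 1 / 2 := by simp
  have hm := (h.hasMellin_muntz (s := s - 1 / 2) (by rw [hre]; linarith) (by rw [hre]; linarith)
    (by rw [hre]; linarith) (by rw [hre]; linarith)).2
  rw [mellin_rpowExp (by rw [hre]; linarith)] at hm
  have hs : s - 1 / 2 + ((1 / 2 : ℝ) : ℂ) = s := by push_cast; ring
  rw [hs, sub_eq_add_neg s, ← mellin_cpow_smul, ← sub_eq_add_neg] at hm
  rw [← hm]
  refine setIntegral_congr_fun measurableSet_Ioi (fun u (hu : 0 < u) => ?_)
  simp only [smul_eq_mul]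
  rw [sqrtSum_eq hu, Complex.ofReal_mul, Complex.ofReal_cpow hu.le]
  push_cast
  rfl

lemma integral_sqrtSum :
    ((∫ u in Set.Ioi (0 : ℝ), sqrtSum u : ℝ) : ℂ) = riemannZeta (1 / 2) := by
  have h := mellin_sqrtSum (s := 1) (by norm_num) (by norm_num)
  rw [mellin, Complex.Gamma_one, mul_one, show (1 - 1 / 2 : ℂ) = 1 / 2 by norm_num] at h
  rw [← h, ← integral_complex_ofReal]
  simp

/-- Rearrangement of `∑_n d_{1/2}(n) e^{-n x}` as `∑_m ∑_d √d e^{-d m x}`. -/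
lemma tsum_divisorPow {x : ℝ} (hx : 0 < x)
    (hS : Summable fun m : ℕ => powExpSum (1 / 2) ((m + 1 : ℕ) * x)) :
    ∑' n : ℕ, divisorPow (1 / 2) (n + 1) * Real.exp (-((n + 1 : ℕ) : ℝ) * x) =
      ∑' m : ℕ, powExpSum (1 / 2) ((m + 1 : ℕ) * x) := by
  let g : ℕ → ℕ → ℝ := fun m d => (d : ℝ) ^ (1 / 2 : ℝ) * Real.exp (-(d * (m * x)))
  let f : ℕ+ × ℕ+ → ℝ := fun c => g c.1 c.2
  have hinner : ∀ m : ℕ+, HasSum (fun d : ℕ+ => g m d) (powExpSum (1 / 2) (m * x)) := by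
    intro m
    have hm : 0 < (m : ℝ) * x := by have : (0 : ℝ) < m := by exact_mod_cast m.pos
                                    positivity
    have hs : Summable (fun d : ℕ+ => g m d) :=
      (summable_pnat_iff_summable_succ (f := fun d => g m d)).2 (hasSum_powExpSum le_rfl hm).summable
    have := hs.hasSum
    rw [tsum_pnat_eq_tsum_succ (f := fun d => g m d)] at this
    exact this
  have hf : Summable f := by
    rw [summable_prod_of_nonneg (fun c => by positivity)]
    refine ⟨fun m => (hinner m).summable, ?_⟩
    have : (fun m : ℕ+ => ∑' d : ℕ+, f (m, d)) = fun m : ℕ+ => powExpSum (1 / 2) (m * x) :=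
      funext fun m => (hinner m).tsum_eq
    rw [this]
    exact (summable_pnat_iff_summable_succ
      (f := fun m : ℕ => powExpSum (1 / 2) (m * x))).2 hS
  have h1 : ∑' c, f c = ∑' m : ℕ, powExpSum (1 / 2) ((m + 1 : ℕ) * x) := by
    rw [hf.tsum_prod, ← tsum_pnat_eq_tsum_succ (f := fun m : ℕ => powExpSum (1 / 2) (m * x))]
    exact tsum_congr fun m => (hinner m).tsum_eq
  have h2 : ∑' c, f c =
      ∑' n : ℕ, divisorPow (1 / 2) (n + 1) * Real.exp (-((n + 1 : ℕ) : ℝ) * x) := by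
    have hσ := ((sigmaAntidiagonalEquivProd.summable_iff).2 hf).tsum_sigma
    simp only [Function.comp_apply] at hσ
    rw [← sigmaAntidiagonalEquivProd.tsum_eq, hσ,
      ← tsum_pnat_eq_tsum_succ
        (f := fun n : ℕ => divisorPow (1 / 2) n * Real.exp (-(n : ℝ) * x))]
    refine tsum_congr fun n => ?_
    rw [tsum_fintype, Finset.univ_eq_attach]
    have h3 : ∀ c : { c // c ∈ (n : ℕ).divisorsAntidiagonal },
        f (sigmaAntidiagonalEquivProd ⟨n, c⟩) =
          (fun c : ℕ × ℕ => (c.2 : ℝ) ^ (1 / 2 : ℝ) * Real.exp (-(n : ℝ) * x)) c.1 := by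
      intro c
      have hc := (Nat.mem_divisorsAntidiagonal.1 c.2).1
      have hc' : ((c.1.1 : ℕ) : ℝ) * ((c.1.2 : ℕ) : ℝ) = (n : ℕ) := by exact_mod_cast hc
      change (c.1.2 : ℝ) ^ (1 / 2 : ℝ) * Real.exp (-(c.1.2 * (c.1.1 * x))) = _
      rw [← hc']; ring_nf
    rw [Finset.sum_congr rfl (fun c _ => h3 c), Finset.sum_attach _
      (fun c : ℕ × ℕ => (c.2 : ℝ) ^ (1 / 2 : ℝ) * Real.exp (-(n : ℝ) * x)), ← Finset.sum_mul,
      divisorPow, Nat.sum_divisorsAntidiagonal' (fun _ d => (d : ℝ) ^ (1 / 2 : ℝ))]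
  rw [← h2, h1]

lemma Gamma_three_halves : Real.Gamma (3 / 2) = Real.sqrt Real.pi / 2 := by
  rw [show (3 / 2 : ℝ) = 1 / 2 + 1 by norm_num, Real.Gamma_add_one (by norm_num),
    Real.Gamma_one_half_eq]; ring

lemma hasSum_rpow_neg_three_halves :
    HasSum (fun m : ℕ => ((m + 1 : ℕ) : ℝ) ^ (-(3 / 2) : ℝ)) (riemannZeta (3 / 2)).re ∧
      (((riemannZeta (3 / 2)).re : ℝ) : ℂ) = riemannZeta (3 / 2) := by
  have hs : Summable (fun m : ℕ => ((m + 1 : ℕ) : ℝ) ^ (-(3 / 2) : ℝ)) :=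
    (summable_nat_add_iff 1 (f := fun m : ℕ => (m : ℝ) ^ (-(3 / 2) : ℝ))).2
      (Real.summable_nat_rpow.2 (by norm_num))
  have hz : riemannZeta (3 / 2) = ((∑' m : ℕ, ((m + 1 : ℕ) : ℝ) ^ (-(3 / 2) : ℝ) : ℝ) : ℂ) := by
    rw [zeta_eq_tsum_one_div_nat_add_one_cpow (by norm_num), Complex.ofReal_tsum]
    refine tsum_congr fun m => ?_
    rw [Complex.ofReal_cpow (by positivity), one_div, ← Complex.cpow_neg]
    push_cast; rfl
  rw [hz, Complex.ofReal_re]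
  exact ⟨hs.hasSum, rfl⟩

/-- Subtracting the two singular terms from `∑ d_{1/2}(n) e^{-n x}` leaves exactly the Müntz
transform of `sqrtSum`. -/
theorem kernelK_eq {x : ℝ} (hx : 0 < x) : kernelK x = (muntz sqrtSumDeriv x : ℂ) := by
  obtain ⟨C, h⟩ := muntzData_sqrtSum
  have h1 := h.hasSum (by norm_num) (by norm_num) hx
  obtain ⟨hz, hz'⟩ := hasSum_rpow_neg_three_halves
  have h2 := h1.add (hz.mul_left (Real.Gamma (3 / 2) * x ^ (-(3 / 2) : ℝ)))
  have h3 : (fun m : ℕ => sqrtSum ((m + 1 : ℕ) * x) +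
      Real.Gamma (3 / 2) * x ^ (-(3 / 2) : ℝ) * ((m + 1 : ℕ) : ℝ) ^ (-(3 / 2) : ℝ)) =
      fun m : ℕ => powExpSum (1 / 2) ((m + 1 : ℕ) * x) := by
    ext m
    rw [sqrtSum, Real.mul_rpow (by positivity) hx.le]; ring
  rw [h3] at h2
  rw [kernelK, tsum_divisorPow hx h2.summable, h2.tsum_eq, ← integral_sqrtSum, Gamma_three_halves]
  push_cast
  rw [hz']
  ring

theorem hasMellin_kernelK {s : ℂ} (h1 : 1 / 2 < s.re) (h2 : s.re < 1) :
    HasMellin kernelK s (Complex.Gamma s * riemannZeta s * riemannZeta (s - 1 / 2)) := by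
  obtain ⟨C, h⟩ := muntzData_sqrtSum
  have hm := h.hasMellin_muntz (s := s) (by linarith) (by linarith) (by linarith) h2
  rw [mellin_sqrtSum h1 (by linarith)] at hm
  have heq : Set.EqOn (fun t : ℝ => (t : ℂ) ^ (s - 1) • kernelK t)
      (fun t : ℝ => (t : ℂ) ^ (s - 1) • ((muntz sqrtSumDeriv t : ℝ) : ℂ)) (Set.Ioi 0) :=
    fun t ht => by simp only [kernelK_eq ht]
  constructor
  · exact IntegrableOn.congr_fun hm.1 heq.symm measurableSet_Ioi
  · rw [mellin, setIntegral_congr_fun measurableSet_Ioi heq]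
    change mellin _ _ = _
    rw [hm.2]; ring

/-! ### The kernel in exponential coordinates -/

lemma abs_exp_smul_cpow_smul (f : ℝ → ℂ) (s : ℂ) (x : ℝ) :
    |Real.exp x| • (((Real.exp x : ℝ) : ℂ) ^ (s - 1) • f (Real.exp x)) =
      Complex.exp (s * x) * f (Real.exp x) := by
  rw [abs_of_pos (Real.exp_pos x), Complex.real_smul, smul_eq_mul, ← mul_assoc]
  congr 1
  rw [Complex.ofReal_exp, Complex.cpow_def_of_ne_zero (Complex.exp_ne_zero _),
    ← Complex.ofReal_exp, ← Complex.ofReal_log (Real.exp_pos x).le, Real.log_exp,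
    Complex.ofReal_exp, ← Complex.exp_add]
  ring_nf

/-- The substitution `x = e^t` in the Mellin transform. -/
lemma mellinConvergent_iff_integrable_exp (f : ℝ → ℂ) (s : ℂ) :
    MellinConvergent f s ↔ Integrable (fun x : ℝ => Complex.exp (s * x) * f (Real.exp x)) := by
  have h := integrableOn_image_iff_integrableOn_abs_deriv_smul MeasurableSet.univ
    (fun x _ => (Real.hasDerivAt_exp x).hasDerivWithinAt) Real.exp_injective.injOn
    (fun t : ℝ => (t : ℂ) ^ (s - 1) • f t)
  rw [Set.image_univ, Real.range_exp, integrableOn_univ] at h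
  simp_rw [abs_exp_smul_cpow_smul] at h
  exact h

lemma mellin_eq_integral_exp (f : ℝ → ℂ) (s : ℂ) :
    mellin f s = ∫ x : ℝ, Complex.exp (s * x) * f (Real.exp x) := by
  have h := integral_image_eq_integral_abs_deriv_smul MeasurableSet.univ
    (fun x _ => (Real.hasDerivAt_exp x).hasDerivWithinAt) Real.exp_injective.injOn
    (fun t : ℝ => (t : ℂ) ^ (s - 1) • f t)
  rw [Set.image_univ, Real.range_exp, setIntegral_univ] at h
  simp_rw [abs_exp_smul_cpow_smul] at h
  exact h

section

variable {σ : ℝ}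

lemma integrable_expKernel (h1 : 1 / 2 < σ) (h2 : σ < 1) : Integrable (expKernel σ) := by
  have h := (mellinConvergent_iff_integrable_exp kernelK (σ : ℂ)).1
    (hasMellin_kernelK (by simpa using h1) (by simpa using h2)).1
  refine h.congr (Eventually.of_forall fun x => ?_)
  simp only [expKernel]
  push_cast
  rfl

/-- The Fourier transform of `e^{σx} k(e^x)` is the Mellin transform of `k` on `Re s = σ`. -/
lemma integral_exp_mul_expKernel (h1 : 1 / 2 < σ) (h2 : σ < 1) (t : ℝ) :
    ∫ x : ℝ, Complex.exp (-(Complex.I * t * x)) * expKernel σ x =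
      Complex.Gamma (σ - Complex.I * t) * riemannZeta (σ - Complex.I * t) *
        riemannZeta (σ - Complex.I * t - 1 / 2) := by
  have h := (hasMellin_kernelK (s := σ - Complex.I * t) (by simpa using h1) (by simpa using h2)).2
  rw [← h, mellin_eq_integral_exp]
  refine integral_congr_ae (Eventually.of_forall fun x => ?_)
  simp only [expKernel]
  rw [← mul_assoc, Complex.ofReal_exp, ← Complex.exp_add]
  push_cast
  ring_nf

/-- On the line `1 / 2 < Re s = σ < 1` neither `s` nor `s - 1 / 2` is a zero of `ζ` if the Riemann
hypothesis holds. -/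
lemma integral_exp_mul_expKernel_ne_zero (h1 : 1 / 2 < σ) (h2 : σ < 1) (hRH : RiemannHypothesis)
    (t : ℝ) : ∫ x : ℝ, Complex.exp (-(Complex.I * t * x)) * expKernel σ x ≠ 0 := by
  have key : ∀ z : ℂ, 0 < z.re → z.re < 1 → z.re ≠ 1 / 2 → riemannZeta z ≠ 0 := by
    intro z hz0 hz1 hz h
    refine hz (hRH z h ?_ ?_)
    · rintro ⟨n, rfl⟩
      have : (-2 * ((n : ℂ) + 1)).re = -2 * ((n : ℝ) + 1) := by simp
      rw [this] at hz0
      have : (0 : ℝ) ≤ n := n.cast_nonneg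
      linarith
    · rintro rfl; simp at hz1
  rw [integral_exp_mul_expKernel h1 h2]
  have hre : ((σ : ℂ) - Complex.I * t).re = σ := by simp
  have hre' : ((σ : ℂ) - Complex.I * t - 1 / 2).re = σ - 1 / 2 := by simp
  refine mul_ne_zero (mul_ne_zero (Complex.Gamma_ne_zero_of_re_pos ?_) (key _ ?_ ?_ ?_))
    (key _ ?_ ?_ ?_)
  all_goals first | rw [hre] | rw [hre']
  all_goals linarith

/-- The Müntz transform is continuous: for fixed `x`, `{u / x}` jumps only for countably many `u`. -/
lemma MuntzData.continuousAt_muntz {φ φ' : ℝ → ℝ} {a b C τ : ℝ} (h : MuntzData φ φ' a b C)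
    (h0 : 0 ≤ τ) (h1 : τ ≤ 1) (ha : a < τ) (hb : τ < b) {x₀ : ℝ} (hx₀ : 0 < x₀) :
    ContinuousAt (muntz φ') x₀ := by
  have hc : ContinuousAt (fun x : ℝ => x ^ (-τ)) x₀ :=
    Real.continuousAt_rpow_const _ _ (Or.inl hx₀.ne')
  have hev : ∀ᶠ x in 𝓝 x₀, x ^ (-τ) < x₀ ^ (-τ) + 1 := hc.eventually_lt_const (by linarith)
  refine continuousAt_of_dominated
    (bound := fun u => (x₀ ^ (-τ) + 1) * ‖u ^ τ * φ' u‖) ?_ ?_ ?_ ?_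
  · exact Eventually.of_forall fun x =>
      (measurable_fract.comp (measurable_id.div_const x)).aestronglyMeasurable.mul
        h.aestronglyMeasurable_deriv
  · filter_upwards [hev, eventually_gt_nhds hx₀] with x hx hx0
    filter_upwards [ae_restrict_mem measurableSet_Ioi] with u hu
    refine (MuntzData.norm_fract_mul_deriv_le h0 h1 hx0 hu).trans ?_
    gcongr
  · exact (h.integrableOn_rpow_mul_deriv ha hb).norm.const_mul _
  · have hnull : ∀ᵐ u : ℝ, u ∉ Set.range (fun m : ℤ => (m : ℝ) * x₀) :=
      (Set.countable_range _).ae_notMem _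
    filter_upwards [ae_restrict_of_ae hnull] with u hu
    refine ContinuousAt.mul ?_ continuousAt_const
    have hne : ∀ m : ℤ, u / x₀ ≠ m := fun m hm => hu ⟨m, by dsimp only; rw [← hm]; field_simp⟩
    have hf : ContinuousAt Int.fract (u / x₀) := continuousAt_fract (hne _)
    exact ContinuousAt.comp (f := fun x => u / x) hf
      (continuousAt_const.div continuousAt_id hx₀.ne')

lemma continuous_expKernel (σ : ℝ) : Continuous (expKernel σ) := by
  obtain ⟨C, h⟩ := muntzData_sqrtSum
  have heq : expKernel σ = fun x : ℝ =>
      (Real.exp (σ * x) : ℂ) * ((muntz sqrtSumDeriv (Real.exp x) : ℝ) : ℂ) := by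
    funext x; rw [expKernel, kernelK_eq (Real.exp_pos x)]
  rw [heq]
  have hm : Continuous fun x : ℝ => muntz sqrtSumDeriv (Real.exp x) := by
    rw [continuous_iff_continuousAt]
    intro x
    exact ContinuousAt.comp (g := muntz sqrtSumDeriv)
      (h.continuousAt_muntz (τ := 1) zero_le_one le_rfl (by norm_num) (by norm_num)
        (Real.exp_pos x)) Real.continuous_exp.continuousAt
  fun_prop

lemma exists_norm_expKernel_le (h1 : 1 / 2 < σ) (h2 : σ < 1) :
    ∃ B : ℝ, ∀ x, ‖expKernel σ x‖ ≤ B := by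
  obtain ⟨C, h⟩ := muntzData_sqrtSum
  obtain ⟨B, -, hB⟩ := h.abs_muntz_le (τ := σ) (by linarith) h2.le h1 (by linarith)
  refine ⟨B, fun x => ?_⟩
  rw [expKernel, kernelK_eq (Real.exp_pos x), norm_mul, Complex.norm_real, Complex.norm_real,
    Real.norm_of_nonneg (Real.exp_pos _).le, Real.norm_eq_abs]
  have h3 := hB _ (Real.exp_pos x)
  rw [← Real.exp_mul] at h3
  calc Real.exp (σ * x) * |muntz sqrtSumDeriv (Real.exp x)|
      ≤ Real.exp (σ * x) * (B * Real.exp (x * -σ)) := by gcongr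
    _ = B * (Real.exp (σ * x) * Real.exp (x * -σ)) := by ring
    _ = B := by rw [← Real.exp_add, show σ * x + x * -σ = 0 by ring, Real.exp_zero, mul_one]

lemma im_expKernel (σ x : ℝ) : (expKernel σ x).im = 0 := by
  rw [expKernel, kernelK_eq (Real.exp_pos x), ← Complex.ofReal_mul, Complex.ofReal_im]

/-! ### The convolution -/

variable {f : ℝ → ℂ}

lemma integrable_mul_expKernel (h1 : 1 / 2 < σ) (h2 : σ < 1) (hf : Integrable f) (x : ℝ) :
    Integrable (fun u : ℝ => f u * expKernel σ (x - u)) := by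
  obtain ⟨B, hB⟩ := exists_norm_expKernel_le h1 h2
  exact hf.mul_bdd (c := B)
    ((continuous_expKernel σ).comp (continuous_const.sub continuous_id)).aestronglyMeasurable
    (Eventually.of_forall fun u => hB _)

lemma convI_eq_convolution (f : ℝ → ℂ) (σ : ℝ) :
    convI f σ = convolution f (expKernel σ) (ContinuousLinearMap.mul ℂ ℂ) volume := rfl

lemma continuous_convI (h1 : 1 / 2 < σ) (h2 : σ < 1) (hf : Integrable f) :
    Continuous (convI f σ) := by
  obtain ⟨B, hB⟩ := exists_norm_expKernel_le h1 h2
  have hK := continuous_expKernel σ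
  refine continuous_of_dominated (bound := fun u => ‖f u‖ * B)
    (fun x => (integrable_mul_expKernel h1 h2 hf x).aestronglyMeasurable)
    (fun x => Eventually.of_forall fun u => ?_) (hf.norm.mul_const B)
    (Eventually.of_forall fun u => by fun_prop)
  rw [norm_mul]
  gcongr
  exact hB _

lemma exists_norm_convI_le (h1 : 1 / 2 < σ) (h2 : σ < 1) (hf : Integrable f) :
    ∃ B : ℝ, ∀ x, ‖convI f σ x‖ ≤ B := by
  obtain ⟨B, hB⟩ := exists_norm_expKernel_le h1 h2
  refine ⟨∫ u, ‖f u‖ * B, fun x => norm_integral_le_of_norm_le (hf.norm.mul_const B)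
    (Eventually.of_forall fun u => ?_)⟩
  rw [norm_mul]
  gcongr
  exact hB _

lemma integrable_convI (h1 : 1 / 2 < σ) (h2 : σ < 1) (hf : Integrable f) :
    Integrable (convI f σ) := by
  rw [convI_eq_convolution]
  exact hf.integrable_convolution _ (integrable_expKernel h1 h2)

/-- The Fourier integral of the convolution is the product of the Fourier integrals. -/
lemma integral_exp_mul_convI (h1 : 1 / 2 < σ) (h2 : σ < 1) (hf : Integrable f) (t : ℝ) :
    ∫ x : ℝ, Complex.exp (-(Complex.I * t * x)) * convI f σ x =
      (∫ x : ℝ, Complex.exp (-(Complex.I * t * x)) * f x) *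
        ∫ x : ℝ, Complex.exp (-(Complex.I * t * x)) * expKernel σ x := by
  have hchar : ∀ g : ℝ → ℂ, Integrable g →
      Integrable fun x : ℝ => Complex.exp (-(Complex.I * t * x)) * g x := by
    intro g hg
    refine hg.bdd_mul (c := 1) (by fun_prop) (Eventually.of_forall fun x => ?_)
    rw [Complex.norm_exp]; simp
  have h := integral_convolution (L := ContinuousLinearMap.mul ℂ ℂ) (μ := volume) (ν := volume)
    (hchar f hf) (hchar _ (integrable_expKernel h1 h2))
  simp only [ContinuousLinearMap.mul_apply'] at h
  rw [← h]
  refine integral_congr_ae (Eventually.of_forall fun x => ?_)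
  simp only [convolution, ContinuousLinearMap.mul_apply', convI]
  rw [← integral_const_mul]
  refine integral_congr_ae (Eventually.of_forall fun u => ?_)
  have : Complex.exp (-(Complex.I * t * x)) =
      Complex.exp (-(Complex.I * t * u)) * Complex.exp (-(Complex.I * t * ((x - u : ℝ) : ℂ))) := by
    rw [← Complex.exp_add]; push_cast; ring_nf
  simp only [this]; ring

end

/-! ### Horizontal integrals of functions analytic in the upper half-plane -/

lemma continuousOn_horizontal {P : ℂ → ℂ} (hP : DifferentiableOn ℂ P {z : ℂ | 0 < z.im}) :
    ContinuousOn (fun p : ℝ × ℝ => P ((p.1 : ℂ) + Complex.I * (p.2 : ℂ)))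
      (Set.univ ×ˢ Set.Ioi 0) := by
  refine hP.continuousOn.comp (by fun_prop) (fun p hp => ?_)
  simpa using hp.2

lemma continuous_horizontal {P : ℂ → ℂ} (hP : DifferentiableOn ℂ P {z : ℂ | 0 < z.im}) {y : ℝ}
    (hy : 0 < y) : Continuous fun x : ℝ => P ((x : ℂ) + Complex.I * (y : ℂ)) := by
  have := (continuousOn_horizontal hP).comp_continuous (f := fun x : ℝ => (x, y)) (by fun_prop)
    (fun x => ⟨trivial, hy⟩)
  exact this

/-- Shifting the line of integration. The vertical sides of the rectangle `[-R, R] × [y₁, y₂]`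
contribute an integrable function of `R`, so the limit of this contribution has to be zero. -/
lemma integral_horizontal_eq {P : ℂ → ℂ} (hP : DifferentiableOn ℂ P {z : ℂ | 0 < z.im})
    {y₁ y₂ B : ℝ} (hy₁ : 0 < y₁) (hy : y₁ ≤ y₂)
    (hint : ∀ y : ℝ, 0 < y → Integrable fun x : ℝ => P ((x : ℂ) + Complex.I * (y : ℂ)))
    (hB : ∀ y : ℝ, y₁ ≤ y → ∫ x : ℝ, ‖P ((x : ℂ) + Complex.I * (y : ℂ))‖ ≤ B) :
    ∫ x : ℝ, P ((x : ℂ) + Complex.I * (y₁ : ℂ)) = ∫ x : ℝ, P ((x : ℂ) + Complex.I * (y₂ : ℂ)) := by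
  have hy₂ : 0 < y₂ := hy₁.trans_le hy
  have hm : AEStronglyMeasurable (fun p : ℝ × ℝ => P ((p.1 : ℂ) + Complex.I * (p.2 : ℂ)))
      ((volume : Measure ℝ).prod (volume.restrict (Set.Ioc y₁ y₂))) := by
    have h : AEStronglyMeasurable (fun p : ℝ × ℝ => P ((p.1 : ℂ) + Complex.I * (p.2 : ℂ)))
        ((volume.prod volume).restrict (Set.univ ×ˢ Set.Ioc y₁ y₂)) :=
      ((continuousOn_horizontal hP).mono (Set.prod_mono le_rfl fun y hy' =>
        hy₁.trans hy'.1)).aestronglyMeasurable (MeasurableSet.univ.prod measurableSet_Ioc)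
    rwa [← Measure.prod_restrict, Measure.restrict_univ] at h
  have hprod : Integrable (fun p : ℝ × ℝ => P ((p.1 : ℂ) + Complex.I * (p.2 : ℂ)))
      ((volume : Measure ℝ).prod (volume.restrict (Set.Ioc y₁ y₂))) := by
    rw [integrable_prod_iff' hm]
    constructor
    · filter_upwards [ae_restrict_mem measurableSet_Ioc] with y hy'
      exact hint y (hy₁.trans hy'.1)
    · refine Integrable.mono' (integrable_const B) hm.norm.prod_swap.integral_prod_right' ?_
      filter_upwards [ae_restrict_mem measurableSet_Ioc] with y hy'
      rw [Real.norm_of_nonneg (by positivity)]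
      exact hB y hy'.1.le
  set S : ℝ → ℂ := fun R => ∫ y in y₁..y₂, P ((R : ℂ) + Complex.I * (y : ℂ)) with hS
  have hSint : Integrable S := by
    have := hprod.integral_prod_left
    simp only [hS, intervalIntegral.integral_of_le hy]
    exact this
  have hTint : Integrable fun R => Complex.I * (S (-R) - S R) :=
    (hSint.comp_neg.sub hSint).const_mul _
  have hrect : ∀ R : ℝ, (∫ x in (-R)..R, P ((x : ℂ) + Complex.I * (y₁ : ℂ))) -
      (∫ x in (-R)..R, P ((x : ℂ) + Complex.I * (y₂ : ℂ))) = Complex.I * (S (-R) - S R) := by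
    intro R
    have h := Complex.integral_boundary_rect_eq_zero_of_differentiableOn P
      ((-R : ℝ) + Complex.I * (y₁ : ℂ)) ((R : ℝ) + Complex.I * (y₂ : ℂ)) (hP.mono ?_)
    · simp only [Complex.add_re, Complex.ofReal_re, Complex.mul_re, Complex.I_re, zero_mul,
        Complex.I_im, Complex.ofReal_im, mul_zero, sub_zero, add_zero, Complex.add_im,
        Complex.mul_im, one_mul, zero_add, smul_eq_mul] at h
      simp only [hS, mul_comm Complex.I (Complex.ofReal _)]
      linear_combination h
    · intro z hz
      have h2 := hz.2
      simp only [Complex.add_im, Complex.ofReal_im, Complex.mul_im, Complex.I_re, Complex.I_im,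
        Complex.ofReal_re, zero_mul, one_mul, zero_add, Set.mem_preimage,
        Set.uIcc_of_le hy] at h2
      exact hy₁.trans_le h2.1
  have hlim : ∀ y : ℝ, 0 < y → Tendsto (fun R : ℝ => ∫ x in (-R)..R, P ((x : ℂ) + Complex.I * (y : ℂ)))
      atTop (𝓝 (∫ x : ℝ, P ((x : ℂ) + Complex.I * (y : ℂ)))) := fun y hy' =>
    intervalIntegral_tendsto_integral (hint y hy') tendsto_neg_atTop_atBot tendsto_id
  have hT : Tendsto (fun R => Complex.I * (S (-R) - S R)) atTop
      (𝓝 ((∫ x : ℝ, P ((x : ℂ) + Complex.I * (y₁ : ℂ))) -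
        ∫ x : ℝ, P ((x : ℂ) + Complex.I * (y₂ : ℂ)))) :=
    ((hlim y₁ hy₁).sub (hlim y₂ hy₂)).congr hrect
  have hzero := (hTint.integrableAtFilter atTop).eq_zero_of_tendsto (fun s hs => by
    obtain ⟨c, hc⟩ := mem_atTop_sets.1 hs
    refine measure_mono_top (fun x hx => hc x hx) (Real.volume_Ici (a := c))) hT
  exact sub_eq_zero.1 hzero

/-- If moreover the integrals of `‖P‖` over horizontal lines tend to zero at infinity, then the
integral of `P` over every horizontal line vanishes. -/
lemma integral_horizontal_eq_zero {P : ℂ → ℂ} (hP : DifferentiableOn ℂ P {z : ℂ | 0 < z.im})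
    (hint : ∀ y : ℝ, 0 < y → Integrable fun x : ℝ => P ((x : ℂ) + Complex.I * (y : ℂ)))
    {b : ℝ → ℝ} (hb : AntitoneOn b (Set.Ioi 0)) (hb0 : Tendsto b atTop (𝓝 0))
    (hB : ∀ y : ℝ, 0 < y → ∫ x : ℝ, ‖P ((x : ℂ) + Complex.I * (y : ℂ))‖ ≤ b y) {y : ℝ} (hy : 0 < y) :
    ∫ x : ℝ, P ((x : ℂ) + Complex.I * (y : ℂ)) = 0 := by
  rw [← norm_le_zero_iff]
  refine ge_of_tendsto hb0 ?_
  filter_upwards [eventually_ge_atTop y] with y' hy'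
  have hy0 : 0 < y' := hy.trans_le hy'
  rw [integral_horizontal_eq hP hy hy' hint (B := b y)
    (fun t ht => (hB t (hy.trans_le ht)).trans (hb hy (hy.trans_le ht) ht))]
  exact (norm_integral_le_integral_norm _).trans (hB y' hy0)

/-! ### Passage to the boundary -/

/-- Convergence of `∫ ‖dᵢ‖` to zero if `dᵢ → 0` almost everywhere and `‖dᵢ‖ ≤ Hᵢ b` with `Hᵢ`
bounded in `L²` and `b ∈ L²`. It rests on `‖d‖ ≤ min (‖d‖, M b²) + H² / M`. -/
lemma tendsto_integral_norm_of_sq_bound {ι : Type*} {l : Filter ι} [l.IsCountablyGenerated]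
    {d : ι → ℝ → ℂ} {H : ι → ℝ → ℝ} {b : ℝ → ℝ} {C : ℝ}
    (hd : ∀ᶠ i in l, AEStronglyMeasurable (d i)) (hb : ∀ x, 0 ≤ b x)
    (hb2 : Integrable fun x => b x ^ 2)
    (hH0 : ∀ᶠ i in l, ∀ x, 0 ≤ H i x)
    (hH : ∀ᶠ i in l, Integrable (fun x => H i x ^ 2) ∧ ∫ x, H i x ^ 2 ≤ C)
    (hdH : ∀ᶠ i in l, ∀ x, ‖d i x‖ ≤ H i x * b x)
    (hlim : ∀ᵐ x, Tendsto (fun i => d i x) l (𝓝 0)) :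
    Tendsto (fun i => ∫ x, ‖d i x‖) l (𝓝 0) := by
  have key : ∀ M : ℝ, 0 < M → ∀ᶠ i in l,
      ∫ x, ‖d i x‖ ≤ (∫ x, min ‖d i x‖ (M * b x ^ 2)) + C / M := by
    intro M hM
    filter_upwards [hd, hH0, hH, hdH] with i h1 h2 h3 h4
    have hmin : Integrable fun x => min ‖d i x‖ (M * b x ^ 2) := by
      refine Integrable.mono' (hb2.const_mul M) (h1.norm.inf
        (hb2.const_mul M).aestronglyMeasurable) (Eventually.of_forall fun x => ?_)
      rw [Real.norm_of_nonneg (le_min (norm_nonneg _) (by positivity))]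
      exact min_le_right _ _
    have hsum := hmin.add (h3.1.div_const M)
    have hle : ∫ x, ‖d i x‖ ≤ ∫ x, (min ‖d i x‖ (M * b x ^ 2) + H i x ^ 2 / M) := by
      refine integral_mono_of_nonneg (Eventually.of_forall fun x => norm_nonneg _) hsum
        (Eventually.of_forall fun x => ?_)
      dsimp only
      have hHM : 0 ≤ H i x ^ 2 / M := by positivity
      rcases le_total ‖d i x‖ (M * b x ^ 2) with h | h
      · rw [min_eq_left h]; linarith
      · rw [min_eq_right h]
        refine (h4 x).trans ?_
        have : H i x ^ 2 / M + M * b x ^ 2 - H i x * b x =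
          ((H i x - M * b x / 2) ^ 2 + 3 / 4 * (M * b x) ^ 2) / M := by field_simp; ring
        have h5 : 0 ≤ ((H i x - M * b x / 2) ^ 2 + 3 / 4 * (M * b x) ^ 2) / M := by positivity
        linarith
    rw [integral_add hmin (h3.1.div_const M), integral_div] at hle
    refine hle.trans ?_
    gcongr
    exact h3.2
  have hminlim : ∀ M : ℝ, 0 < M → Tendsto (fun i => ∫ x, min ‖d i x‖ (M * b x ^ 2)) l (𝓝 0) := by
    intro M hM
    rw [← integral_zero ℝ ℝ (μ := volume)]
    refine tendsto_integral_filter_of_dominated_convergence (fun x => M * b x ^ 2) ?_ ?_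
      (hb2.const_mul M) ?_
    · filter_upwards [hd] with i h1
      exact h1.norm.inf (hb2.const_mul M).aestronglyMeasurable
    · refine Eventually.of_forall fun i => Eventually.of_forall fun x => ?_
      have := hb x
      rw [Real.norm_of_nonneg (le_min (norm_nonneg _) (by positivity))]
      exact min_le_right _ _
    · filter_upwards [hlim] with x hx
      have h0 := hx.norm.min (tendsto_const_nhds (x := M * b x ^ 2))
      rwa [norm_zero, min_eq_left (by positivity)] at h0
  rw [Metric.tendsto_nhds]
  intro ε hε
  -- `M` is so large that the part `H² / M` of the majorant contributes less than `ε / 2`.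
  set M : ℝ := 2 * |C| / ε + 1 with hMdef
  have hM : 0 < M := by positivity
  have hCM : C / M < ε / 2 := by
    rw [div_lt_iff₀ hM, hMdef]
    have : ε / 2 * (2 * |C| / ε + 1) = |C| + ε / 2 := by field_simp
    rw [this]
    linarith [le_abs_self C]
  filter_upwards [key M hM, (Metric.tendsto_nhds.1 (hminlim M hM)) (ε / 2) (by positivity)]
    with i h1 h2
  rw [Real.dist_eq, sub_zero] at h2 ⊢
  rw [abs_of_nonneg (by positivity)]
  have := lt_of_abs_lt h2
  linarith

lemma integrable_sq_norm_of_lintegral_le {h : ℝ → ℂ} (hm : AEStronglyMeasurable h) {C : ℝ}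
    (hC0 : 0 ≤ C) (hC : ∫⁻ x, ‖h x‖ₑ ^ 2 ≤ ENNReal.ofReal C) :
    Integrable (fun x => ‖h x‖ ^ 2) ∧ ∫ x, ‖h x‖ ^ 2 ≤ C := by
  have heq : ∀ x, ENNReal.ofReal (‖h x‖ ^ 2) = ‖h x‖ₑ ^ 2 := fun x => by
    rw [ENNReal.ofReal_pow (norm_nonneg _), ofReal_norm]
  constructor
  · refine ⟨hm.norm.pow 2, ?_⟩
    rw [hasFiniteIntegral_iff_ofReal (Eventually.of_forall fun x => by positivity)]
    simp_rw [heq]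
    exact hC.trans_lt ENNReal.ofReal_lt_top
  · rw [integral_eq_lintegral_of_nonneg_ae (f := fun x => ‖h x‖ ^ 2)
      (Eventually.of_forall fun x => by positivity)
      (hm.norm.pow 2)]
    simp_rw [heq]
    exact ENNReal.toReal_le_of_le_ofReal hC0 hC

/-- The test function `e^{-itz} / (1 - iεz)²`. For `t < 0` it decays exponentially as
`Im z → ∞`; the denominator makes it integrable on horizontal lines. -/
def expTest (t ε : ℝ) (z : ℂ) : ℂ :=
  Complex.exp (-(Complex.I * t * z)) / (1 - Complex.I * ε * z) ^ 2

lemma normSq_expTest_denom (ε x y : ℝ) :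
    ‖1 - Complex.I * ε * ((x : ℂ) + Complex.I * (y : ℂ))‖ ^ 2 = (1 + ε * y) ^ 2 + (ε * x) ^ 2 := by
  rw [← Complex.normSq_eq_norm_sq, Complex.normSq_apply]
  simp; ring

lemma norm_expTest_le (t : ℝ) {ε : ℝ} (hε : 0 ≤ ε) (x : ℝ) {y : ℝ} (hy : 0 ≤ y) :
    ‖expTest t ε ((x : ℂ) + Complex.I * (y : ℂ))‖ ≤ Real.exp (t * y) * (1 + (ε * x) ^ 2)⁻¹ := by
  rw [expTest, norm_div, norm_pow, normSq_expTest_denom, Complex.norm_exp, div_eq_mul_inv]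
  have h1 : (-(Complex.I * t * ((x : ℂ) + Complex.I * (y : ℂ)))).re = t * y := by simp
  rw [h1]
  gcongr
  nlinarith [mul_nonneg hε hy]

lemma expTest_denom_ne_zero {ε : ℝ} (hε : 0 ≤ ε) {z : ℂ} (hz : 0 ≤ z.im) :
    1 - Complex.I * ε * z ≠ 0 := by
  intro h
  have := congrArg Complex.re h
  simp at this
  nlinarith [mul_nonneg hε hz]

lemma continuousAt_expTest (t : ℝ) {ε : ℝ} (hε : 0 ≤ ε) {z : ℂ} (hz : 0 ≤ z.im) :
    ContinuousAt (expTest t ε) z := by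
  unfold expTest
  exact ContinuousAt.div (by fun_prop) (by fun_prop) (pow_ne_zero _ (expTest_denom_ne_zero hε hz))

lemma differentiableOn_expTest (t : ℝ) {ε : ℝ} (hε : 0 ≤ ε) :
    DifferentiableOn ℂ (expTest t ε) {z : ℂ | 0 < z.im} := by
  intro z hz
  unfold expTest
  refine DifferentiableAt.differentiableWithinAt (DifferentiableAt.div (by fun_prop) (by fun_prop)
    (pow_ne_zero _ (expTest_denom_ne_zero hε (le_of_lt hz))))

lemma integrable_inv_one_add_mul_sq {ε : ℝ} (hε : 0 < ε) :
    Integrable fun x : ℝ => (1 + (ε * x) ^ 2)⁻¹ :=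
  integrable_inv_one_add_sq.comp_mul_left' hε.ne'

lemma integrable_inv_one_add_mul_sq_sq {ε : ℝ} (hε : 0 < ε) :
    Integrable fun x : ℝ => ((1 + (ε * x) ^ 2)⁻¹) ^ 2 := by
  refine (integrable_inv_one_add_mul_sq hε).mono' ?_ (Eventually.of_forall fun x => ?_)
  · exact ((integrable_inv_one_add_mul_sq hε).aestronglyMeasurable).pow 2
  · rw [Real.norm_of_nonneg (by positivity), pow_two]
    refine mul_le_of_le_one_right (by positivity) (inv_le_one_of_one_le₀ ?_)
    nlinarith [sq_nonneg (ε * x)]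

/-- A boundary function `g` of an element `G` of the Hardy space `H²` of the upper half-plane is
orthogonal to the test functions. -/
lemma integral_boundary_mul_expTest_eq_zero {G : ℂ → ℂ} {g : ℝ → ℂ} {C t ε : ℝ} (hC0 : 0 ≤ C)
    (hG : DifferentiableOn ℂ G {z : ℂ | 0 < z.im})
    (hC : ∀ y : ℝ, 0 < y → ∫⁻ x : ℝ, ‖G ((x : ℂ) + Complex.I * (y : ℂ))‖ₑ ^ 2 ≤ ENNReal.ofReal C)
    (hlim : ∀ᵐ x : ℝ, Tendsto (fun y : ℝ => G ((x : ℂ) + Complex.I * (y : ℂ))) (𝓝[>] 0) (𝓝 (g x)))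
    (hg : Integrable g) (hg2 : Integrable fun x => ‖g x‖ ^ 2) (ht : t < 0) (hε : 0 < ε) :
    ∫ x : ℝ, g x * expTest t ε x = 0 := by
  set b : ℝ → ℝ := fun x => (1 + (ε * x) ^ 2)⁻¹ with hb
  have hb0 : ∀ x, 0 ≤ b x := fun x => by positivity
  have hb2 : Integrable fun x => b x ^ 2 := integrable_inv_one_add_mul_sq_sq hε
  have hG2 : ∀ y : ℝ, 0 < y → _ := fun y hy => integrable_sq_norm_of_lintegral_le
    (continuous_horizontal hG hy).aestronglyMeasurable hC0 (hC y hy)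
  have hP : DifferentiableOn ℂ (fun z => G z * expTest t ε z) {z : ℂ | 0 < z.im} :=
    hG.mul (differentiableOn_expTest t hε.le)
  have hbound : ∀ y : ℝ, 0 < y → ∀ x : ℝ,
      ‖G ((x : ℂ) + Complex.I * (y : ℂ)) * expTest t ε ((x : ℂ) + Complex.I * (y : ℂ))‖ ≤
        Real.exp (t * y) * (‖G ((x : ℂ) + Complex.I * (y : ℂ))‖ ^ 2 + b x ^ 2) := by
    intro y hy x
    rw [norm_mul]
    calc _ ≤ ‖G ((x : ℂ) + Complex.I * (y : ℂ))‖ * (Real.exp (t * y) * b x) := by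
          gcongr; exact norm_expTest_le t hε.le x hy.le
      _ = Real.exp (t * y) * (‖G ((x : ℂ) + Complex.I * (y : ℂ))‖ * b x) := by ring
      _ ≤ _ := by
          gcongr
          nlinarith [sq_nonneg (‖G ((x : ℂ) + Complex.I * (y : ℂ))‖ - b x),
            sq_nonneg ‖G ((x : ℂ) + Complex.I * (y : ℂ))‖, sq_nonneg (b x)]
  have hmaj : ∀ y : ℝ, 0 < y → Integrable fun x : ℝ =>
      Real.exp (t * y) * (‖G ((x : ℂ) + Complex.I * (y : ℂ))‖ ^ 2 + b x ^ 2) :=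
    fun y hy => ((hG2 y hy).1.add hb2).const_mul _
  have hint : ∀ y : ℝ, 0 < y → Integrable fun x : ℝ => G ((x : ℂ) + Complex.I * (y : ℂ)) *
      expTest t ε ((x : ℂ) + Complex.I * (y : ℂ)) := fun y hy =>
    (hmaj y hy).mono' (continuous_horizontal hP hy).aestronglyMeasurable
      (Eventually.of_forall (hbound y hy))
  have hB : ∀ y : ℝ, 0 < y → ∫ x : ℝ, ‖G ((x : ℂ) + Complex.I * (y : ℂ)) *
      expTest t ε ((x : ℂ) + Complex.I * (y : ℂ))‖ ≤ Real.exp (t * y) * (C + ∫ x, b x ^ 2) := by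
    intro y hy
    refine (integral_mono (hint y hy).norm (hmaj y hy) (hbound y hy)).trans ?_
    rw [integral_const_mul, integral_add (hG2 y hy).1 hb2]
    gcongr
    exact (hG2 y hy).2
  have hD : 0 ≤ C + ∫ x, b x ^ 2 := by positivity
  have hzero : ∀ y : ℝ, 0 < y → ∫ x : ℝ, G ((x : ℂ) + Complex.I * (y : ℂ)) *
      expTest t ε ((x : ℂ) + Complex.I * (y : ℂ)) = 0 := by
    intro y hy
    refine integral_horizontal_eq_zero hP hint
      (b := fun y => Real.exp (t * y) * (C + ∫ x, b x ^ 2)) ?_ ?_ hB hy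
    · intro y₁ _ y₂ _ h
      dsimp only
      gcongr 1
      exact Real.exp_le_exp.2 (mul_le_mul_of_nonpos_left h ht.le)
    · rw [← zero_mul (C + ∫ x, b x ^ 2)]
      exact (Real.tendsto_exp_atBot.comp (tendsto_id.const_mul_atTop_of_neg ht)).mul_const _
  have hφ0 : ∀ x : ℝ, ‖expTest t ε x‖ ≤ b x := fun x => by
    simpa using norm_expTest_le t hε.le x le_rfl
  have hφm : Continuous fun x : ℝ => expTest t ε x := by
    rw [continuous_iff_continuousAt]
    intro x
    exact ContinuousAt.comp (continuousAt_expTest t hε.le (by simp))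
      Complex.continuous_ofReal.continuousAt
  have hgφ : Integrable fun x : ℝ => g x * expTest t ε x := by
    refine hg.mul_bdd (c := 1) hφm.aestronglyMeasurable (Eventually.of_forall fun x => ?_)
    refine (hφ0 x).trans (inv_le_one_of_one_le₀ ?_)
    nlinarith [sq_nonneg (ε * x)]
  have hT := tendsto_integral_norm_of_sq_bound (l := 𝓝[>] (0 : ℝ))
    (d := fun y x => G ((x : ℂ) + Complex.I * (y : ℂ)) *
      expTest t ε ((x : ℂ) + Complex.I * (y : ℂ)) - g x * expTest t ε x)
    (H := fun y x => ‖G ((x : ℂ) + Complex.I * (y : ℂ))‖ + ‖g x‖) (b := b)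
    (C := 2 * C + 2 * ∫ x, ‖g x‖ ^ 2) ?_ hb0 hb2 ?_ ?_ ?_ ?_
  · have hT2 : Tendsto (fun _ : ℝ => ‖∫ x : ℝ, g x * expTest t ε x‖) (𝓝[>] 0) (𝓝 0) := by
      refine squeeze_zero' (Eventually.of_forall fun _ => norm_nonneg _) ?_ hT
      filter_upwards [self_mem_nhdsWithin] with y (hy : 0 < y)
      refine le_trans ?_ (norm_integral_le_integral_norm _)
      rw [integral_sub (hint y hy) hgφ, hzero y hy, zero_sub, norm_neg]
    have := tendsto_nhds_unique hT2 tendsto_const_nhds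
    exact norm_eq_zero.1 this.symm
  · filter_upwards [self_mem_nhdsWithin] with y (hy : 0 < y)
    exact (hint y hy).aestronglyMeasurable.sub hgφ.aestronglyMeasurable
  · exact Eventually.of_forall fun y x => by positivity
  · filter_upwards [self_mem_nhdsWithin] with y (hy : 0 < y)
    have h1 := hG2 y hy
    have h2 : Integrable fun x : ℝ =>
        2 * ‖G ((x : ℂ) + Complex.I * (y : ℂ))‖ ^ 2 + 2 * ‖g x‖ ^ 2 :=
      (h1.1.const_mul 2).add (hg2.const_mul 2)
    have hle : ∀ x : ℝ, (‖G ((x : ℂ) + Complex.I * (y : ℂ))‖ + ‖g x‖) ^ 2 ≤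
        2 * ‖G ((x : ℂ) + Complex.I * (y : ℂ))‖ ^ 2 + 2 * ‖g x‖ ^ 2 := fun x => by
      nlinarith [sq_nonneg (‖G ((x : ℂ) + Complex.I * (y : ℂ))‖ - ‖g x‖)]
    have h3 : Integrable fun x : ℝ => (‖G ((x : ℂ) + Complex.I * (y : ℂ))‖ + ‖g x‖) ^ 2 := by
      refine h2.mono' ?_ (Eventually.of_forall fun x => ?_)
      · exact ((continuous_horizontal hG hy).aestronglyMeasurable.norm.add
          hg.aestronglyMeasurable.norm).pow 2
      · rw [Real.norm_of_nonneg (by positivity)]; exact hle x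
    refine ⟨h3, (integral_mono h3 h2 hle).trans ?_⟩
    rw [integral_add (h1.1.const_mul 2) (hg2.const_mul 2), integral_const_mul, integral_const_mul]
    linarith [h1.2]
  · filter_upwards [self_mem_nhdsWithin] with y (hy : 0 < y)
    intro x
    refine (norm_sub_le _ _).trans ?_
    rw [norm_mul, norm_mul, add_mul]
    gcongr
    · refine (norm_expTest_le t hε.le x hy.le).trans ?_
      refine mul_le_of_le_one_left (hb0 x) (Real.exp_le_one_iff.2 ?_)
      exact mul_nonpos_of_nonpos_of_nonneg ht.le hy.le
    · exact hφ0 x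
  · filter_upwards [hlim] with x hx
    have h1 : Tendsto (fun y : ℝ => expTest t ε ((x : ℂ) + Complex.I * (y : ℂ))) (𝓝[>] 0)
        (𝓝 (expTest t ε x)) := by
      have hc : Tendsto (fun y : ℝ => (x : ℂ) + Complex.I * (y : ℂ)) (𝓝[>] 0) (𝓝 (x : ℂ)) := by
        have : Continuous fun y : ℝ => (x : ℂ) + Complex.I * (y : ℂ) := by fun_prop
        simpa using (this.tendsto 0).mono_left nhdsWithin_le_nhds
      exact (continuousAt_expTest t hε.le (by simp)).tendsto.comp hc
    simpa using (hx.mul h1).sub_const (g x * expTest t ε x)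

/-- Boundary functions of the Hardy space `H²` of the upper half-plane have no negative
frequencies. -/
theorem integral_exp_mul_boundary_eq_zero {G : ℂ → ℂ} {g : ℝ → ℂ} {C t : ℝ} (hC0 : 0 ≤ C)
    (hG : DifferentiableOn ℂ G {z : ℂ | 0 < z.im})
    (hC : ∀ y : ℝ, 0 < y → ∫⁻ x : ℝ, ‖G ((x : ℂ) + Complex.I * (y : ℂ))‖ₑ ^ 2 ≤ ENNReal.ofReal C)
    (hlim : ∀ᵐ x : ℝ, Tendsto (fun y : ℝ => G ((x : ℂ) + Complex.I * (y : ℂ))) (𝓝[>] 0) (𝓝 (g x)))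
    (hg : Integrable g) (hg2 : Integrable fun x => ‖g x‖ ^ 2) (ht : t < 0) :
    ∫ x : ℝ, Complex.exp (-(Complex.I * t * x)) * g x = 0 := by
  have hε0 : Tendsto (fun ε : ℝ => ∫ x : ℝ, g x * expTest t ε x) (𝓝[>] 0)
      (𝓝 (∫ x : ℝ, Complex.exp (-(Complex.I * t * x)) * g x)) := by
    refine tendsto_integral_filter_of_dominated_convergence (fun x => ‖g x‖) ?_ ?_ hg.norm ?_
    · filter_upwards [self_mem_nhdsWithin] with ε (hε : 0 < ε)
      refine hg.aestronglyMeasurable.mul (Continuous.aestronglyMeasurable ?_)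
      rw [continuous_iff_continuousAt]
      intro x
      exact ContinuousAt.comp (continuousAt_expTest t hε.le (by simp))
        Complex.continuous_ofReal.continuousAt
    · filter_upwards [self_mem_nhdsWithin] with ε (hε : 0 < ε)
      refine Eventually.of_forall fun x => ?_
      rw [norm_mul]
      refine mul_le_of_le_one_right (norm_nonneg _) ?_
      have h := norm_expTest_le t hε.le x le_rfl
      simp only [Complex.ofReal_zero, mul_zero, add_zero, Real.exp_zero, one_mul] at h
      refine h.trans (inv_le_one_of_one_le₀ ?_)
      nlinarith [sq_nonneg (ε * x)]
    · refine Eventually.of_forall fun x => ?_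
      have hc : ContinuousAt (fun ε : ℝ => g x * expTest t ε x) 0 := by
        unfold expTest
        refine continuousAt_const.mul (ContinuousAt.div (by fun_prop) (by fun_prop) (by simp))
      have := hc.tendsto.mono_left (nhdsWithin_le_nhds (s := Set.Ioi 0))
      simpa [expTest, mul_comm] using this
  refine tendsto_nhds_unique hε0 ?_
  refine (tendsto_const_nhds (x := (0 : ℂ))).congr' ?_
  filter_upwards [self_mem_nhdsWithin] with ε (hε : 0 < ε)
  exact (integral_boundary_mul_expTest_eq_zero hC0 hG hC hlim hg hg2 ht hε).symm

/-! ### Cauchy and Poisson integrals -/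

/-- Cauchy–Schwarz and Tonelli: an average of functions `k(·, s)` with `‖k(·, s)‖₂² ≤ A` against a
weight `w` has squared `L²` norm at most `(∫ w)² A`. -/
lemma lintegral_sq_lintegral_mul_le {w : ℝ → ENNReal} {k : ℝ → ℝ → ENNReal} (hw : Measurable w)
    (hk : Measurable (Function.uncurry k)) {A : ENNReal} (hA : ∀ s, ∫⁻ x, k x s ^ 2 ≤ A) :
    ∫⁻ x, (∫⁻ s, w s * k x s) ^ 2 ≤ (∫⁻ s, w s) ^ 2 * A := by
  have hkx : ∀ x, Measurable (k x) := fun x => hk.comp (measurable_const.prodMk measurable_id)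
  have hCS : ∀ x, (∫⁻ s, w s * k x s) ^ 2 ≤ (∫⁻ s, w s) * ∫⁻ s, w s * k x s ^ 2 := by
    intro x
    have h := ENNReal.lintegral_mul_le_Lp_mul_Lq (volume.withDensity w)
      Real.HolderConjugate.two_two (hkx x).aemeasurable (aemeasurable_const (b := (1 : ENNReal)))
    simp only [ENNReal.rpow_two, one_pow, Pi.mul_apply, mul_one] at h
    rw [lintegral_withDensity_eq_lintegral_mul _ hw (hkx x),
      lintegral_withDensity_eq_lintegral_mul _ hw ((hkx x).pow_const 2), lintegral_one,
      withDensity_apply _ MeasurableSet.univ, Measure.restrict_univ] at h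
    simp only [Pi.mul_apply] at h
    calc _ ≤ ((∫⁻ s, w s * k x s ^ 2) ^ (1 / 2 : ℝ) * (∫⁻ s, w s) ^ (1 / 2 : ℝ)) ^ 2 := by gcongr
      _ = _ := by
        rw [mul_pow, ← ENNReal.rpow_two, ← ENNReal.rpow_two, ← ENNReal.rpow_mul,
          ← ENNReal.rpow_mul]
        norm_num [mul_comm]
  calc ∫⁻ x, (∫⁻ s, w s * k x s) ^ 2 ≤ ∫⁻ x, (∫⁻ s, w s) * ∫⁻ s, w s * k x s ^ 2 :=
        lintegral_mono hCS
    _ = (∫⁻ s, w s) * ∫⁻ x, ∫⁻ s, w s * k x s ^ 2 := by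
        refine lintegral_const_mul _ (Measurable.lintegral_prod_right'
          (f := fun p : ℝ × ℝ => w p.2 * k p.1 p.2 ^ 2) ?_)
        exact (hw.comp measurable_snd).mul (hk.pow_const 2)
    _ = (∫⁻ s, w s) * ∫⁻ s, ∫⁻ x, w s * k x s ^ 2 := by
        rw [lintegral_lintegral_swap]
        exact ((hw.comp measurable_snd).mul (hk.pow_const 2)).aemeasurable
    _ ≤ (∫⁻ s, w s) * ∫⁻ s, w s * A := by
        gcongr with s
        have hks : Measurable fun x => k x s := hk.comp (measurable_id.prodMk measurable_const)
        rw [lintegral_const_mul _ (hks.pow_const 2)]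
        gcongr
        exact hA s
    _ = (∫⁻ s, w s) ^ 2 * A := by
        rw [lintegral_mul_const _ hw]; ring

/-- The Cauchy density `π⁻¹ (1 + s²)⁻¹`, i.e. the Poisson kernel of the upper half-plane at height
`1`. -/
def poissonWeight (s : ℝ) : ℝ := Real.pi⁻¹ * (1 + s ^ 2)⁻¹

lemma poissonWeight_nonneg (s : ℝ) : 0 ≤ poissonWeight s := by
  unfold poissonWeight; positivity

lemma continuous_poissonWeight : Continuous poissonWeight := by
  unfold poissonWeight
  exact continuous_const.mul (Continuous.inv₀ (by fun_prop) (fun s => by positivity))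

lemma integrable_poissonWeight : Integrable poissonWeight :=
  integrable_inv_one_add_sq.const_mul _

lemma integral_poissonWeight : ∫ s, poissonWeight s = 1 := by
  simp only [poissonWeight]
  rw [integral_const_mul, integral_univ_inv_one_add_sq, inv_mul_cancel₀ Real.pi_ne_zero]

lemma lintegral_poissonWeight : ∫⁻ s, ENNReal.ofReal (poissonWeight s) = 1 := by
  rw [← ofReal_integral_eq_lintegral_ofReal integrable_poissonWeight
    (Eventually.of_forall poissonWeight_nonneg), integral_poissonWeight, ENNReal.ofReal_one]

/-- The Poisson extension of `v`, with the integration variable rescaled so that the boundary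
values are included. -/
def poissonExt (v : ℝ → ℂ) (z : ℂ) : ℂ := ∫ s : ℝ, (poissonWeight s : ℂ) * v (z.re + z.im * s)

lemma continuous_poissonExt {v : ℝ → ℂ} (hv : Continuous v) {B : ℝ} (hB : ∀ x, ‖v x‖ ≤ B) :
    Continuous (poissonExt v) := by
  have hw := continuous_poissonWeight
  refine continuous_of_dominated (bound := fun s => poissonWeight s * B)
    (fun z => Continuous.aestronglyMeasurable (by fun_prop))
    (fun z => Eventually.of_forall fun s => ?_) (integrable_poissonWeight.mul_const B)
    (Eventually.of_forall fun s => by fun_prop)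
  rw [norm_mul, Complex.norm_real, Real.norm_of_nonneg (poissonWeight_nonneg s)]
  exact mul_le_mul_of_nonneg_left (hB _) (poissonWeight_nonneg s)

lemma poissonExt_ofReal (v : ℝ → ℂ) (x : ℝ) : poissonExt v x = v x := by
  simp only [poissonExt, Complex.ofReal_re, Complex.ofReal_im, zero_mul, add_zero]
  rw [integral_mul_const, integral_complex_ofReal, integral_poissonWeight]; simp

lemma lintegral_sq_poissonExt_le {v : ℝ → ℂ} (hv : Continuous v) (y : ℝ) :
    ∫⁻ x : ℝ, ‖poissonExt v ((x : ℂ) + Complex.I * (y : ℂ))‖ₑ ^ 2 ≤ ∫⁻ x, ‖v x‖ₑ ^ 2 := by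
  have h := lintegral_sq_lintegral_mul_le (w := fun s => ENNReal.ofReal (poissonWeight s))
    (k := fun x s => ‖v (x + y * s)‖ₑ) (A := ∫⁻ x, ‖v x‖ₑ ^ 2)
    continuous_poissonWeight.measurable.ennreal_ofReal
    (Continuous.measurable (by unfold Function.uncurry; fun_prop))
    (fun s => (lintegral_add_right_eq_self (fun x => ‖v x‖ₑ ^ 2) (y * s)).le)
  rw [lintegral_poissonWeight, one_pow, one_mul] at h
  refine le_trans (lintegral_mono fun x => ?_) h
  gcongr
  refine (enorm_integral_le_lintegral_enorm _).trans (lintegral_mono fun s => ?_)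
  rw [enorm_mul]
  simp only [Complex.add_re, Complex.ofReal_re, Complex.mul_re, Complex.I_re, zero_mul,
    Complex.I_im, Complex.ofReal_im, mul_zero, sub_zero, add_zero, Complex.add_im,
    Complex.mul_im, one_mul, zero_add]
  gcongr
  rw [← ofReal_norm, Complex.norm_real, Real.norm_of_nonneg (poissonWeight_nonneg s)]

/-- The affine substitution `u = x + y s`. -/
lemma integral_eq_integral_affine {E : Type*} [NormedAddCommGroup E] [NormedSpace ℝ E] (g : ℝ → E)
    (x : ℝ) {y : ℝ} (hy : 0 < y) : ∫ u, g u = ∫ s, y • g (x + y * s) := by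
  rw [integral_smul, Measure.integral_comp_mul_left (fun t => g (x + t)) y,
    integral_add_left_eq_self g x, abs_of_pos (inv_pos.2 hy), smul_smul, mul_inv_cancel₀ hy.ne',
    one_smul]

lemma poissonExt_eq (v : ℝ → ℂ) (x : ℝ) {y : ℝ} (hy : 0 < y) :
    poissonExt v ((x : ℂ) + Complex.I * (y : ℂ)) =
      ∫ u : ℝ, ((Real.pi⁻¹ * (y / ((u - x) ^ 2 + y ^ 2)) : ℝ) : ℂ) * v u := by
  rw [integral_eq_integral_affine _ x hy]
  simp only [poissonExt, poissonWeight, Complex.add_re, Complex.ofReal_re, Complex.mul_re,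
    Complex.I_re, zero_mul, Complex.I_im, Complex.ofReal_im, mul_zero, sub_zero, add_zero,
    Complex.add_im, Complex.mul_im, one_mul, zero_add]
  refine integral_congr_ae (Eventually.of_forall fun s => ?_)
  dsimp only
  rw [Complex.real_smul, ← mul_assoc, ← Complex.ofReal_mul]
  congr 2
  have : (1 + s ^ 2) ≠ 0 := by positivity
  rw [add_sub_cancel_left, mul_pow]
  have h2 : y ^ 2 * s ^ 2 + y ^ 2 ≠ 0 := by positivity
  field_simp
  ring

lemma ofReal_sub_ne_zero {z : ℂ} (hz : z.im ≠ 0) (u : ℝ) : (u : ℂ) - z ≠ 0 := by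
  intro h
  have := congrArg Complex.im h
  simp at this
  exact hz this

lemma abs_im_le_norm_ofReal_sub (z : ℂ) (u : ℝ) : |z.im| ≤ ‖(u : ℂ) - z‖ := by
  have := Complex.abs_im_le_norm ((u : ℂ) - z)
  simpa using this

lemma continuous_inv_ofReal_sub {z : ℂ} (hz : z.im ≠ 0) : Continuous fun u : ℝ => ((u : ℂ) - z)⁻¹ :=
  Continuous.inv₀ (by fun_prop) (ofReal_sub_ne_zero hz)

lemma integrable_inv_ofReal_sub_mul {v : ℝ → ℂ} (hv : Integrable v) {z : ℂ} (hz : z.im ≠ 0) :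
    Integrable fun u : ℝ => ((u : ℂ) - z)⁻¹ * v u := by
  refine hv.bdd_mul (c := |z.im|⁻¹) (continuous_inv_ofReal_sub hz).aestronglyMeasurable
    (Eventually.of_forall fun u => ?_)
  rw [norm_inv]
  exact inv_anti₀ (abs_pos.2 hz) (abs_im_le_norm_ofReal_sub z u)

/-- The Cauchy integral `∫ v(u) / (u - z) du`. -/
def cauchyInt (v : ℝ → ℂ) (z : ℂ) : ℂ := ∫ u : ℝ, ((u : ℂ) - z)⁻¹ * v u

lemma differentiableOn_cauchyInt {v : ℝ → ℂ} (hv : Integrable v) :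
    DifferentiableOn ℂ (cauchyInt v) {z : ℂ | 0 < z.im} := by
  intro z₀ (hz₀ : 0 < z₀.im)
  have hball : ∀ z ∈ Metric.ball z₀ (z₀.im / 2), z₀.im / 2 ≤ z.im := by
    intro z hz
    have h1 : |(z - z₀).im| < z₀.im / 2 :=
      (Complex.abs_im_le_norm _).trans_lt (by simpa [dist_eq_norm] using hz)
    rw [Complex.sub_im] at h1
    linarith [neg_lt_of_abs_lt h1]
  have h := hasDerivAt_integral_of_dominated_loc_of_deriv_le (μ := volume) (𝕜 := ℂ)
    (F := fun (z : ℂ) (u : ℝ) => ((u : ℂ) - z)⁻¹ * v u)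
    (F' := fun (z : ℂ) (u : ℝ) => (((u : ℂ) - z) ^ 2)⁻¹ * v u)
    (bound := fun u => ((z₀.im / 2) ^ 2)⁻¹ * ‖v u‖) (x₀ := z₀)
    (Metric.ball_mem_nhds z₀ (half_pos hz₀)) ?_ ?_ ?_ ?_ ?_ ?_
  · exact h.2.differentiableAt.differentiableWithinAt
  · filter_upwards [Metric.ball_mem_nhds z₀ (half_pos hz₀)] with z hz
    exact (integrable_inv_ofReal_sub_mul hv (by linarith [hball z hz] : 0 < z.im).ne').aestronglyMeasurable
  · exact integrable_inv_ofReal_sub_mul hv hz₀.ne'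
  · refine (Continuous.aestronglyMeasurable ?_).mul hv.aestronglyMeasurable
    exact Continuous.inv₀ (by fun_prop) (fun u => pow_ne_zero _ (ofReal_sub_ne_zero hz₀.ne' u))
  · refine Eventually.of_forall fun u z hz => ?_
    rw [norm_mul, norm_inv, norm_pow]
    have h1 := hball z hz
    have h2 := abs_im_le_norm_ofReal_sub z u
    rw [abs_of_pos (by linarith)] at h2
    gcongr
    linarith
  · exact hv.norm.const_mul _
  · refine Eventually.of_forall fun u z hz => ?_
    have hz' : z.im ≠ 0 := (by linarith [hball z hz] : 0 < z.im).ne'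
    have h1 : HasDerivAt (fun z : ℂ => (u : ℂ) - z) (-1) z := by
      simpa using (hasDerivAt_id z).const_sub (u : ℂ)
    have h2 := (h1.inv (ofReal_sub_ne_zero hz' u)).mul_const (v u)
    refine h2.congr_deriv ?_
    simp

/-- If `v` has no negative frequencies, then its Cauchy integral vanishes in the lower half-plane,
because `1 / (u - w) = -i ∫_0^∞ e^{isu} e^{-isw} ds` there. -/
lemma cauchyInt_eq_zero_of_im_neg {v : ℝ → ℂ} (hv : Integrable v)
    (h : ∀ t : ℝ, t < 0 → ∫ x : ℝ, Complex.exp (-(Complex.I * t * x)) * v x = 0)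
    {w : ℂ} (hw : w.im < 0) : cauchyInt v w = 0 := by
  have hre : ∀ u : ℝ, (Complex.I * ((u : ℂ) - w)).re < 0 := fun u => by simpa using hw
  have hE : IntegrableOn (fun s : ℝ => Real.exp (w.im * s)) (Set.Ioi 0) := by
    simpa using integrableOn_exp_mul_Ioi hw 0
  have hprod : Integrable (Function.uncurry fun u s : ℝ =>
      Complex.exp (Complex.I * ((u : ℂ) - w) * s) * v u)
      (volume.prod (volume.restrict (Set.Ioi 0))) := by
    refine (hv.norm.mul_prod hE).mono' ?_ (Eventually.of_forall fun p => ?_)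
    · refine AEStronglyMeasurable.mul (Continuous.aestronglyMeasurable ?_)
        hv.aestronglyMeasurable.comp_fst
      fun_prop
    · simp only [Function.uncurry]
      rw [norm_mul, Complex.norm_exp, mul_comm]
      gcongr
      simp
  have hinner : ∀ u : ℝ, ∫ s in Set.Ioi (0 : ℝ),
      Complex.exp (Complex.I * ((u : ℂ) - w) * s) * v u = Complex.I * (((u : ℂ) - w)⁻¹ * v u) := by
    intro u
    rw [integral_mul_const, integral_exp_mul_complex_Ioi (hre u)]
    have := ofReal_sub_ne_zero hw.ne u
    have hI := Complex.I_ne_zero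
    simp only [Complex.ofReal_zero, mul_zero, Complex.exp_zero]
    field_simp
    rw [Complex.I_sq, neg_one_mul]
  have h1 : Complex.I * cauchyInt v w = 0 := by
    rw [cauchyInt, ← integral_const_mul]
    simp_rw [← hinner]
    rw [integral_integral_swap hprod]
    refine integral_eq_zero_of_ae ?_
    filter_upwards [ae_restrict_mem measurableSet_Ioi] with s (hs : 0 < s)
    have h2 := h (-s) (by linarith)
    have h3 : ∀ u : ℝ, Complex.exp (Complex.I * ((u : ℂ) - w) * s) * v u =
        Complex.exp (-(Complex.I * w * s)) *
          (Complex.exp (-(Complex.I * ((-s : ℝ) : ℂ) * u)) * v u) := by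
      intro u
      rw [← mul_assoc, ← Complex.exp_add]
      push_cast
      ring_nf
    simp_rw [h3]
    rw [integral_const_mul, h2, mul_zero]; rfl
  exact (mul_eq_zero.1 h1).resolve_left Complex.I_ne_zero

lemma inv_ofReal_sub_eq (u x : ℝ) {y : ℝ} (hy : y ≠ 0) :
    ((u : ℂ) - ((x : ℂ) + Complex.I * (y : ℂ)))⁻¹ =
      (((u - x) / ((u - x) ^ 2 + y ^ 2) : ℝ) : ℂ) +
        Complex.I * ((y / ((u - x) ^ 2 + y ^ 2) : ℝ) : ℂ) := by
  have h1 : (u - x) ^ 2 + y ^ 2 ≠ 0 := by positivity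
  have h1' : ((u : ℂ) - x) ^ 2 + (y : ℂ) ^ 2 ≠ 0 := by exact_mod_cast h1
  refine inv_eq_of_mul_eq_one_left ?_
  push_cast
  field_simp
  ring_nf
  rw [Complex.I_sq]; ring

/-- If `v` has no negative frequencies, then its Cauchy integral is its Poisson extension. -/
lemma cauchyInt_eq_poissonExt {v : ℝ → ℂ} (hv : Integrable v)
    (h : ∀ t : ℝ, t < 0 → ∫ x : ℝ, Complex.exp (-(Complex.I * t * x)) * v x = 0)
    (x : ℝ) {y : ℝ} (hy : 0 < y) :
    cauchyInt v ((x : ℂ) + Complex.I * (y : ℂ)) =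
      2 * Real.pi * Complex.I * poissonExt v ((x : ℂ) + Complex.I * (y : ℂ)) := by
  have h0 := cauchyInt_eq_zero_of_im_neg hv h (w := (x : ℂ) + Complex.I * ((-y : ℝ) : ℂ))
    (by simpa using hy)
  rw [← sub_zero (cauchyInt v _), ← h0, poissonExt_eq v x hy, cauchyInt, cauchyInt,
    ← integral_sub (integrable_inv_ofReal_sub_mul hv (by simpa using hy.ne'))
      (integrable_inv_ofReal_sub_mul hv (by simpa using hy.ne')), ← integral_const_mul]
  refine integral_congr_ae (Eventually.of_forall fun u => ?_)
  dsimp only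
  rw [inv_ofReal_sub_eq u x hy.ne', inv_ofReal_sub_eq u x (neg_ne_zero.2 hy.ne')]
  have hpi : (Real.pi : ℂ) ≠ 0 := by exact_mod_cast Real.pi_ne_zero
  rw [neg_sq, neg_div]
  push_cast
  field_simp
  ring

/-- The Poisson extension of an integrable function without negative frequencies is analytic. -/
theorem differentiableOn_poissonExt {v : ℝ → ℂ} (hv : Integrable v)
    (h : ∀ t : ℝ, t < 0 → ∫ x : ℝ, Complex.exp (-(Complex.I * t * x)) * v x = 0) :
    DifferentiableOn ℂ (poissonExt v) {z : ℂ | 0 < z.im} := by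
  have h1 : DifferentiableOn ℂ (fun z => (2 * Real.pi * Complex.I)⁻¹ * cauchyInt v z)
      {z : ℂ | 0 < z.im} := (differentiableOn_cauchyInt hv).const_mul _
  refine h1.congr (fun z (hz : 0 < z.im) => ?_)
  have hz' : z = (z.re : ℂ) + Complex.I * (z.im : ℂ) := by
    rw [mul_comm]; exact (Complex.re_add_im z).symm
  have := cauchyInt_eq_poissonExt hv h z.re hz
  rw [← hz'] at this
  rw [this, inv_mul_cancel_left₀]
  simp [Real.pi_ne_zero]

/-! ### Hilbert transforms -/

/-- The conjugate Poisson integral of a real function. -/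
def conjPoisson (v : ℝ → ℝ) (x y : ℝ) : ℝ :=
  ∫ u : ℝ, Real.pi⁻¹ * ((u - x) / ((u - x) ^ 2 + y ^ 2) * v u)

/-- The difference of the conjugate Poisson kernel at height `1` and the truncated Hilbert kernel
`s⁻¹ 1_{|s| > 1}`, up to the factor `π`. -/
def hilbertDiff (s : ℝ) : ℝ := s / (1 + s ^ 2) - {s : ℝ | 1 < |s|}.indicator (fun s => s⁻¹) s

lemma measurableSet_one_lt_abs : MeasurableSet {s : ℝ | 1 < |s|} :=
  measurableSet_lt measurable_const measurable_norm

lemma abs_hilbertDiff_le (s : ℝ) : |hilbertDiff s| ≤ (1 + s ^ 2)⁻¹ := by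
  have h0 : 0 < 1 + s ^ 2 := by positivity
  by_cases hs : 1 < |s|
  · have hs0 : s ≠ 0 := by rintro rfl; simp at hs; linarith
    rw [hilbertDiff, Set.indicator_of_mem (show s ∈ {s : ℝ | 1 < |s|} from hs)]
    have : s / (1 + s ^ 2) - s⁻¹ = -(s⁻¹ * (1 + s ^ 2)⁻¹) := by field_simp; ring
    rw [this, abs_neg, abs_mul, abs_of_pos (inv_pos.2 h0), abs_inv]
    exact mul_le_of_le_one_left (by positivity) (inv_le_one_of_one_le₀ hs.le)
  · rw [hilbertDiff, Set.indicator_of_notMem (show s ∉ {s : ℝ | 1 < |s|} from hs), sub_zero, abs_div,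
      abs_of_pos h0, div_eq_mul_inv]
    exact mul_le_of_le_one_left (by positivity) (not_lt.1 hs)

lemma measurable_hilbertDiff : Measurable hilbertDiff := by
  unfold hilbertDiff
  exact (measurable_id.div (by fun_prop)).sub
    (measurable_inv.indicator measurableSet_one_lt_abs)

lemma integral_hilbertDiff : ∫ s, hilbertDiff s = 0 := by
  have hodd : ∀ s, hilbertDiff (-s) = -hilbertDiff s := by
    intro s
    unfold hilbertDiff
    by_cases hs : 1 < |s|
    · rw [Set.indicator_of_mem (show s ∈ {s : ℝ | 1 < |s|} from hs),
        Set.indicator_of_mem (show -s ∈ {s : ℝ | 1 < |s|} by simpa using hs), inv_neg]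
      ring
    · rw [Set.indicator_of_notMem (show s ∉ {s : ℝ | 1 < |s|} from hs),
        Set.indicator_of_notMem (show -s ∉ {s : ℝ | 1 < |s|} by simpa using hs)]
      ring
  have h := integral_neg_eq_self hilbertDiff volume
  simp_rw [hodd] at h
  rw [integral_neg] at h
  linarith

lemma integrable_conjPoisson_integrand {v : ℝ → ℝ} (hv : Integrable v) (x : ℝ) {y : ℝ}
    (hy : 0 < y) : Integrable fun u : ℝ => (u - x) / ((u - x) ^ 2 + y ^ 2) * v u := by
  refine hv.bdd_mul (c := y⁻¹) (Continuous.aestronglyMeasurable ?_)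
    (Eventually.of_forall fun u => ?_)
  · exact Continuous.div (by fun_prop) (by fun_prop) (fun u => by positivity)
  · have h0 : 0 < (u - x) ^ 2 + y ^ 2 := by positivity
    rw [Real.norm_eq_abs, abs_div, abs_of_pos h0, div_le_iff₀ h0, ← mul_le_mul_iff_right₀ hy,
      ← mul_assoc, mul_inv_cancel₀ hy.ne', one_mul, ← sq_abs (u - x)]
    nlinarith [sq_nonneg (|u - x| - y), sq_nonneg |u - x|, sq_nonneg y]

/-- At a point of continuity of a bounded function, the conjugate Poisson integrals and the
truncated Hilbert integrals have the same limit. -/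
lemma tendsto_conjPoisson {v : ℝ → ℝ} (hv : Integrable v) (hc : Continuous v) {B : ℝ}
    (hB : ∀ x, |v x| ≤ B) {x L : ℝ}
    (hL : Tendsto (fun ε : ℝ => (1 / Real.pi) * ∫ u in {u : ℝ | ε < |u - x|}, v u / (u - x))
      (𝓝[>] 0) (𝓝 L)) :
    Tendsto (fun y => conjPoisson v x y) (𝓝[>] 0) (𝓝 L) := by
  have hdiff : ∀ y : ℝ, 0 < y →
      conjPoisson v x y - (1 / Real.pi) * ∫ u in {u : ℝ | y < |u - x|}, v u / (u - x) =
        ∫ s, Real.pi⁻¹ * (hilbertDiff s * v (x + y * s)) := by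
    intro y hy
    have hset : MeasurableSet {u : ℝ | y < |u - x|} :=
      measurableSet_lt measurable_const (measurable_norm.comp (measurable_id.sub_const x))
    have hHint : Integrable ({u : ℝ | y < |u - x|}.indicator fun u => v u / (u - x)) := by
      refine (hv.norm.mul_const y⁻¹).mono' ?_ (Eventually.of_forall fun u => ?_)
      · exact AEStronglyMeasurable.indicator (hv.aestronglyMeasurable.div₀
          (by fun_prop : Continuous fun u : ℝ => u - x).aestronglyMeasurable) hset
      · by_cases hu : y < |u - x|
        · rw [Set.indicator_of_mem (show u ∈ {u : ℝ | y < |u - x|} from hu), norm_div,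
            div_eq_mul_inv, Real.norm_eq_abs (u - x)]
          gcongr
        · rw [Set.indicator_of_notMem (show u ∉ {u : ℝ | y < |u - x|} from hu), norm_zero]
          positivity
    rw [conjPoisson, integral_const_mul, ← integral_indicator hset, one_div, ← mul_sub,
      ← integral_sub (integrable_conjPoisson_integrand hv x hy) hHint, ← integral_const_mul,
      integral_eq_integral_affine _ x hy]
    refine integral_congr_ae (Eventually.of_forall fun s => ?_)
    dsimp only
    have h1 : (1 + s ^ 2) ≠ 0 := by positivity
    have h2 : y ^ 2 * s ^ 2 + y ^ 2 ≠ 0 := by positivity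
    have h3 : (y * s) / ((y * s) ^ 2 + y ^ 2) = y⁻¹ * (s / (1 + s ^ 2)) := by
      rw [mul_pow]; field_simp; ring
    have h4 : {u : ℝ | y < |u - x|}.indicator (fun u => v u / (u - x)) (x + y * s) =
        y⁻¹ * ({s : ℝ | 1 < |s|}.indicator (fun s => s⁻¹) s * v (x + y * s)) := by
      have hiff : x + y * s ∈ {u : ℝ | y < |u - x|} ↔ s ∈ {s : ℝ | 1 < |s|} := by
        simp only [Set.mem_ofPred_eq, add_sub_cancel_left, abs_mul, abs_of_pos hy]
        exact lt_mul_iff_one_lt_right hy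
      by_cases hs : s ∈ {s : ℝ | 1 < |s|}
      · rw [Set.indicator_of_mem hs, Set.indicator_of_mem (hiff.2 hs), add_sub_cancel_left,
          div_eq_mul_inv, mul_inv]
        ring
      · rw [Set.indicator_of_notMem hs, Set.indicator_of_notMem (fun h => hs (hiff.1 h))]
        ring
    rw [h4, add_sub_cancel_left, h3, hilbertDiff, smul_eq_mul]
    field_simp
  have hlim : Tendsto (fun y : ℝ => ∫ s, Real.pi⁻¹ * (hilbertDiff s * v (x + y * s))) (𝓝[>] 0)
      (𝓝 0) := by
    have hcont : Continuous fun y : ℝ => ∫ s, Real.pi⁻¹ * (hilbertDiff s * v (x + y * s)) := by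
      have hm := measurable_hilbertDiff
      refine continuous_of_dominated (bound := fun s => Real.pi⁻¹ * ((1 + s ^ 2)⁻¹ * B))
        (fun y => ?_) (fun y => Eventually.of_forall fun s => ?_)
        ((integrable_inv_one_add_sq.mul_const B).const_mul _)
        (Eventually.of_forall fun s => by fun_prop)
      · exact ((hm.mul (hc.comp (by fun_prop)).measurable).const_mul _).aestronglyMeasurable
      · rw [norm_mul, norm_mul, Real.norm_of_nonneg (by positivity), Real.norm_eq_abs,
          Real.norm_eq_abs]
        gcongr
        · exact abs_hilbertDiff_le s
        · exact hB _
    have h0 := (hcont.tendsto 0).mono_left (nhdsWithin_le_nhds (s := Set.Ioi 0))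
    simp only [zero_mul, add_zero] at h0
    rwa [integral_const_mul, integral_mul_const, integral_hilbertDiff, zero_mul, mul_zero] at h0
  have := (hL.add hlim).congr' (f₂ := fun y => conjPoisson v x y) (by
    filter_upwards [self_mem_nhdsWithin] with y hy
    rw [← hdiff y hy]; ring)
  simpa using this

/-- The function `(πi)⁻¹ ∫ v(u) / (u - z) du`, which is `P_y v - i Q_y v` on the line `Im z = y`
with the Poisson and conjugate Poisson integrals of `v`. -/
def hilbertExt (v : ℝ → ℝ) (z : ℂ) : ℂ :=
  (Real.pi * Complex.I)⁻¹ * cauchyInt (fun u => (v u : ℂ)) z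

lemma poissonExt_eq_re (v : ℝ → ℝ) (z : ℂ) :
    poissonExt (fun u => (v u : ℂ)) z = (((poissonExt (fun u => (v u : ℂ)) z).re : ℝ) : ℂ) := by
  have : poissonExt (fun u => (v u : ℂ)) z =
      ((∫ s : ℝ, poissonWeight s * v (z.re + z.im * s) : ℝ) : ℂ) := by
    rw [poissonExt, ← integral_complex_ofReal]
    simp
  rw [this, Complex.ofReal_re]

lemma hilbertExt_eq {v : ℝ → ℝ} (hv : Integrable v) (x : ℝ) {y : ℝ} (hy : 0 < y) :
    hilbertExt v ((x : ℂ) + Complex.I * (y : ℂ)) =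
      poissonExt (fun u => (v u : ℂ)) ((x : ℂ) + Complex.I * (y : ℂ)) -
        Complex.I * (conjPoisson v x y : ℂ) := by
  have hq : Integrable fun u : ℝ => (Real.pi : ℂ) *
      ((Real.pi⁻¹ * ((u - x) / ((u - x) ^ 2 + y ^ 2) * v u) : ℝ) : ℂ) :=
    ((integrable_conjPoisson_integrand hv x hy).const_mul _).ofReal.const_mul _
  have h1 : cauchyInt (fun u => (v u : ℂ)) ((x : ℂ) + Complex.I * (y : ℂ)) =
      Real.pi * (conjPoisson v x y : ℂ) + Real.pi * Complex.I *
        poissonExt (fun u => (v u : ℂ)) ((x : ℂ) + Complex.I * (y : ℂ)) := by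
    have hcau : Integrable fun u : ℝ =>
        ((u : ℂ) - ((x : ℂ) + Complex.I * (y : ℂ)))⁻¹ * (v u : ℂ) :=
      integrable_inv_ofReal_sub_mul hv.ofReal (by simpa using hy.ne')
    rw [← sub_eq_iff_eq_add', poissonExt_eq _ x hy, conjPoisson, ← integral_complex_ofReal,
      ← integral_const_mul, ← integral_const_mul, cauchyInt, ← integral_sub hcau hq]
    refine integral_congr_ae (Eventually.of_forall fun u => ?_)
    dsimp only
    rw [inv_ofReal_sub_eq u x hy.ne']
    push_cast
    field_simp
    ring
  rw [hilbertExt, h1]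
  field_simp
  linear_combination (conjPoisson v x y : ℂ) * Complex.I_sq

lemma differentiableOn_hilbertExt {v : ℝ → ℝ} (hv : Integrable v) :
    DifferentiableOn ℂ (hilbertExt v) {z : ℂ | 0 < z.im} :=
  (differentiableOn_cauchyInt hv.ofReal).const_mul _

lemma lintegral_sq_enorm_inv_ofReal_sub (u : ℝ) {y : ℝ} (hy : 0 < y) :
    ∫⁻ x : ℝ, ‖((u : ℂ) - ((x : ℂ) + Complex.I * (y : ℂ)))⁻¹‖ₑ ^ 2 =
      ENNReal.ofReal (Real.pi / y) := by
  have h1 : ∫ x : ℝ, Real.pi⁻¹ * (y / ((x - u) ^ 2 + y ^ 2)) = 1 := by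
    have h := poissonExt_eq (fun _ => 1) u hy
    simp only [mul_one, poissonExt] at h
    rw [integral_complex_ofReal, integral_complex_ofReal, integral_poissonWeight] at h
    exact_mod_cast h.symm
  have h2 : Integrable fun x : ℝ => Real.pi⁻¹ * (y / ((x - u) ^ 2 + y ^ 2)) := by
    by_contra hcon
    rw [integral_undef hcon] at h1
    exact zero_ne_one h1
  have h3 : ∀ x : ℝ, ‖((u : ℂ) - ((x : ℂ) + Complex.I * (y : ℂ)))⁻¹‖ₑ ^ 2 =
      ENNReal.ofReal (Real.pi / y * (Real.pi⁻¹ * (y / ((x - u) ^ 2 + y ^ 2)))) := by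
    intro x
    rw [← ofReal_norm, ← ENNReal.ofReal_pow (norm_nonneg _), norm_inv, inv_pow,
      ← Complex.normSq_eq_norm_sq, Complex.normSq_apply]
    congr 1
    have h4 : (x - u) ^ 2 + y ^ 2 ≠ 0 := by positivity
    have h5 := Real.pi_ne_zero
    simp only [Complex.sub_re, Complex.add_re, Complex.ofReal_re, Complex.mul_re, Complex.I_re,
      zero_mul, Complex.I_im, Complex.ofReal_im, mul_zero, sub_zero, add_zero, Complex.sub_im,
      Complex.add_im, Complex.mul_im, one_mul, zero_add, zero_sub]
    rw [show (u - x) * (u - x) + -y * -y = (x - u) ^ 2 + y ^ 2 by ring]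
    field_simp
  simp_rw [h3]
  rw [← ofReal_integral_eq_lintegral_ofReal (h2.const_mul _)
    (Eventually.of_forall fun x => by positivity), integral_const_mul, h1, mul_one]

/-- A crude bound, used only to see that `∫ |G(x + iy)|² dx` is finite and decays as `y → ∞`. -/
lemma exists_lintegral_sq_hilbertExt_le {v : ℝ → ℝ} (hv : Integrable v) (hc : Continuous v) :
    ∃ K : ℝ, 0 ≤ K ∧ ∀ y : ℝ, 0 < y →
      ∫⁻ x : ℝ, ‖hilbertExt v ((x : ℂ) + Complex.I * (y : ℂ))‖ₑ ^ 2 ≤ ENNReal.ofReal (K / y) := by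
  set N : ℝ := ∫ u, ‖v u‖ with hN
  have hN0 : 0 ≤ N := by positivity
  have hNe : ∫⁻ u, ‖(v u : ℂ)‖ₑ = ENNReal.ofReal N := by
    rw [hN, ofReal_integral_eq_lintegral_ofReal hv.norm
      (Eventually.of_forall fun u => norm_nonneg _)]
    refine lintegral_congr fun u => ?_
    rw [← ofReal_norm, Complex.norm_real]
  refine ⟨Real.pi⁻¹ ^ 2 * (N ^ 2 * Real.pi), by positivity, fun y hy => ?_⟩
  have h := lintegral_sq_lintegral_mul_le (w := fun u => ‖(v u : ℂ)‖ₑ)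
    (k := fun x u => ‖((u : ℂ) - ((x : ℂ) + Complex.I * (y : ℂ)))⁻¹‖ₑ)
    (Continuous.measurable (by fun_prop)) ?_
    (fun u => (lintegral_sq_enorm_inv_ofReal_sub u hy).le)
  · rw [hNe] at h
    have hscal : ‖(Real.pi * Complex.I : ℂ)⁻¹‖ₑ = ENNReal.ofReal Real.pi⁻¹ := by
      rw [← ofReal_norm, norm_inv, norm_mul, Complex.norm_I, mul_one, Complex.norm_real,
        Real.norm_of_nonneg Real.pi_pos.le]
    calc ∫⁻ x : ℝ, ‖hilbertExt v ((x : ℂ) + Complex.I * (y : ℂ))‖ₑ ^ 2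
        ≤ ∫⁻ x : ℝ, ENNReal.ofReal Real.pi⁻¹ ^ 2 *
          (∫⁻ u, ‖(v u : ℂ)‖ₑ * ‖((u : ℂ) - ((x : ℂ) + Complex.I * (y : ℂ)))⁻¹‖ₑ) ^ 2 := by
          refine lintegral_mono fun x => ?_
          rw [hilbertExt, enorm_mul, mul_pow, hscal]
          gcongr
          refine (enorm_integral_le_lintegral_enorm _).trans (lintegral_mono fun u => ?_)
          rw [enorm_mul, mul_comm]
      _ = ENNReal.ofReal Real.pi⁻¹ ^ 2 * ∫⁻ x : ℝ,
          (∫⁻ u, ‖(v u : ℂ)‖ₑ * ‖((u : ℂ) - ((x : ℂ) + Complex.I * (y : ℂ)))⁻¹‖ₑ) ^ 2 :=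
          lintegral_const_mul' _ _ (by simp)
      _ ≤ ENNReal.ofReal Real.pi⁻¹ ^ 2 * (ENNReal.ofReal N ^ 2 * ENNReal.ofReal (Real.pi / y)) := by
          gcongr
      _ = _ := by
          rw [← ENNReal.ofReal_pow (by positivity), ← ENNReal.ofReal_pow hN0,
            ← ENNReal.ofReal_mul (by positivity), ← ENNReal.ofReal_mul (by positivity)]
          congr 1; ring
  · refine Continuous.measurable ?_
    refine Continuous.enorm (Continuous.inv₀ (by fun_prop) (fun p => ?_))
    exact ofReal_sub_ne_zero (by simpa using hy.ne') p.2

/-- `G = hilbertExt v` belongs to `H²` if `v` is in `L²`: as `∫ G(x + iy)² dx = 0`, the real part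
`P_y v` and the imaginary part of `G` have equal norms. -/
lemma lintegral_sq_hilbertExt_le {v : ℝ → ℝ} (hv : Integrable v) (hc : Continuous v) {C : ℝ}
    (hC0 : 0 ≤ C) (hC : ∫⁻ x, ‖(v x : ℂ)‖ₑ ^ 2 ≤ ENNReal.ofReal C) {y : ℝ} (hy : 0 < y) :
    ∫⁻ x : ℝ, ‖hilbertExt v ((x : ℂ) + Complex.I * (y : ℂ))‖ₑ ^ 2 ≤ ENNReal.ofReal (2 * C) := by
  obtain ⟨K, hK0, hK⟩ := exists_lintegral_sq_hilbertExt_le hv hc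
  have hd := differentiableOn_hilbertExt hv
  have hG2 : ∀ y : ℝ, 0 < y → _ := fun y hy => integrable_sq_norm_of_lintegral_le
    (continuous_horizontal hd hy).aestronglyMeasurable (by positivity) (hK y hy)
  have hPint : ∀ y : ℝ, 0 < y →
      Integrable fun x : ℝ => hilbertExt v ((x : ℂ) + Complex.I * (y : ℂ)) ^ 2 := fun y hy =>
    (hG2 y hy).1.mono' ((continuous_horizontal hd hy).pow 2).aestronglyMeasurable
      (Eventually.of_forall fun x => by rw [norm_pow])
  have hzero : ∫ x : ℝ, hilbertExt v ((x : ℂ) + Complex.I * (y : ℂ)) ^ 2 = 0 := by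
    refine integral_horizontal_eq_zero (P := fun z => hilbertExt v z ^ 2) (hd.pow 2) hPint
      (b := fun y => K / y) ?_ (tendsto_const_nhds.div_atTop tendsto_id) ?_ hy
    · intro y₁ h1 y₂ _ h
      have h1' : 0 < y₁ := h1
      dsimp only
      gcongr
    · intro y hy
      simp_rw [norm_pow]
      exact (hG2 y hy).2
  have hvc : Continuous fun u => (v u : ℂ) := by fun_prop
  have hp : Continuous fun x : ℝ =>
      poissonExt (fun u => (v u : ℂ)) ((x : ℂ) + Complex.I * (y : ℂ)) := by
    have h1 : ∀ x : ℝ, poissonExt (fun u => (v u : ℂ)) ((x : ℂ) + Complex.I * (y : ℂ)) =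
        (((hilbertExt v ((x : ℂ) + Complex.I * (y : ℂ))).re : ℝ) : ℂ) := by
      intro x
      rw [hilbertExt_eq hv x hy, poissonExt_eq_re]
      simp
    simp_rw [h1]
    exact Complex.continuous_ofReal.comp (Complex.continuous_re.comp (continuous_horizontal hd hy))
  have ha := integrable_sq_norm_of_lintegral_le hp.aestronglyMeasurable hC0
    ((lintegral_sq_poissonExt_le hvc y).trans hC)
  have hpt : ∀ x : ℝ, ‖hilbertExt v ((x : ℂ) + Complex.I * (y : ℂ))‖ ^ 2 =
      2 * ‖poissonExt (fun u => (v u : ℂ)) ((x : ℂ) + Complex.I * (y : ℂ))‖ ^ 2 -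
        (hilbertExt v ((x : ℂ) + Complex.I * (y : ℂ)) ^ 2).re := by
    intro x
    rw [hilbertExt_eq hv x hy, poissonExt_eq_re, ← Complex.normSq_eq_norm_sq,
      ← Complex.normSq_eq_norm_sq, Complex.normSq_apply, Complex.normSq_apply, pow_two]
    simp
    ring
  have hre : ∫ x : ℝ, (hilbertExt v ((x : ℂ) + Complex.I * (y : ℂ)) ^ 2).re = 0 := by
    have := integral_re (𝕜 := ℂ) (hPint y hy)
    simp only [RCLike.re_eq_complex_re] at this
    rw [this, hzero, Complex.zero_re]
  have hint : ∫ x : ℝ, ‖hilbertExt v ((x : ℂ) + Complex.I * (y : ℂ))‖ ^ 2 ≤ 2 * C := by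
    simp_rw [hpt]
    have hrei : Integrable fun x : ℝ => (hilbertExt v ((x : ℂ) + Complex.I * (y : ℂ)) ^ 2).re :=
      (hPint y hy).re
    rw [integral_sub (ha.1.const_mul 2) hrei, integral_const_mul, hre, sub_zero]
    linarith [ha.2]
  calc ∫⁻ x : ℝ, ‖hilbertExt v ((x : ℂ) + Complex.I * (y : ℂ))‖ₑ ^ 2
      = ENNReal.ofReal (∫ x : ℝ, ‖hilbertExt v ((x : ℂ) + Complex.I * (y : ℂ))‖ ^ 2) := by
        rw [ofReal_integral_eq_lintegral_ofReal (hG2 y hy).1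
          (Eventually.of_forall fun x => by positivity)]
        refine lintegral_congr fun x => ?_
        rw [ENNReal.ofReal_pow (norm_nonneg _), ofReal_norm]
    _ ≤ _ := ENNReal.ofReal_le_ofReal hint

/-! ### The boundary value conditions -/

lemma tendsto_vertical (x : ℝ) :
    Tendsto (fun y : ℝ => (x : ℂ) + Complex.I * (y : ℂ)) (𝓝[>] 0)
      (𝓝[{z : ℂ | 0 < z.im}] (x : ℂ)) := by
  refine tendsto_nhdsWithin_iff.2 ⟨?_, ?_⟩
  · have : Continuous fun y : ℝ => (x : ℂ) + Complex.I * (y : ℂ) := by fun_prop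
    simpa using (this.tendsto 0).mono_left nhdsWithin_le_nhds
  · filter_upwards [self_mem_nhdsWithin] with y (hy : 0 < y)
    simpa using hy

lemma IsStrongBoundaryValue.isWeakBoundaryValue {m : ℝ} {g : ℝ → ℂ}
    (h : IsStrongBoundaryValue m g) : IsWeakBoundaryValue m g := by
  obtain ⟨F, hF, hlim⟩ := h
  exact ⟨F, hF, Eventually.of_forall fun x => (hlim x).comp (tendsto_vertical x)⟩

lemma enorm_sq_exp_mul (a x y : ℝ) (w : ℂ) :
    ‖Complex.exp (Complex.I * a * ((x : ℂ) + Complex.I * (y : ℂ))) * w‖ₑ ^ 2 =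
      ENNReal.ofReal (Real.exp (-(2 * a * y))) * ‖w‖ₑ ^ 2 := by
  have h : ‖Complex.exp (Complex.I * a * ((x : ℂ) + Complex.I * (y : ℂ)))‖ = Real.exp (-(a * y)) := by
    rw [Complex.norm_exp]; simp
  rw [enorm_mul, mul_pow, ← ofReal_norm, h, ← ENNReal.ofReal_pow (Real.exp_pos _).le,
    ← Real.exp_nat_mul]
  congr 3
  push_cast
  ring

/-- Multiplication by `e^{imz}` turns the growth condition into membership in `H²`, so a weak
boundary value of growth `m` has no frequencies below `-m`. -/
lemma IsWeakBoundaryValue.integral_exp_eq_zero {m : ℝ} {v : ℝ → ℂ} (hv : Integrable v)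
    (hv2 : Integrable fun x => ‖v x‖ ^ 2)
    (h : IsWeakBoundaryValue m fun x => Complex.exp (-(Complex.I * m * x)) * v x) {t : ℝ}
    (ht : t < 0) : ∫ x : ℝ, Complex.exp (-(Complex.I * t * x)) * v x = 0 := by
  obtain ⟨F, ⟨hF, C, hC0, hC⟩, hlim⟩ := h
  refine integral_exp_mul_boundary_eq_zero (G := fun z => Complex.exp (Complex.I * m * z) * F z)
    hC0.le ?_ ?_ ?_ hv hv2 ht
  · exact DifferentiableOn.mul (Differentiable.differentiableOn (by fun_prop)) hF
  · intro y hy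
    simp_rw [enorm_sq_exp_mul]
    rw [lintegral_const_mul' _ _ ENNReal.ofReal_ne_top]
    calc _ ≤ ENNReal.ofReal (Real.exp (-(2 * m * y))) *
          ENNReal.ofReal (C * Real.exp (2 * m * y)) := by gcongr; exact hC y hy
      _ = ENNReal.ofReal C := by
        rw [← ENNReal.ofReal_mul (Real.exp_pos _).le, mul_left_comm, ← Real.exp_add]
        simp
  · filter_upwards [hlim] with x hx
    have h1 : Tendsto (fun y : ℝ => Complex.exp (Complex.I * m * ((x : ℂ) + Complex.I * (y : ℂ))))
        (𝓝[>] 0) (𝓝 (Complex.exp (Complex.I * m * x))) := by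
      have hc : Continuous fun z : ℂ => Complex.exp (Complex.I * m * z) := by fun_prop
      exact (hc.tendsto (x : ℂ)).comp ((tendsto_vertical x).mono_right nhdsWithin_le_nhds)
    have h2 := h1.mul hx
    rwa [← mul_assoc, ← Complex.exp_add, add_neg_cancel, Complex.exp_zero, one_mul] at h2

lemma isStrongBoundaryValue_of_integral_exp_eq_zero {m : ℝ} {v : ℝ → ℂ} (hc : Continuous v)
    {B : ℝ} (hB : ∀ x, ‖v x‖ ≤ B) (hv : Integrable v) {C : ℝ} (hC0 : 0 < C)
    (hC : ∫⁻ x, ‖v x‖ₑ ^ 2 ≤ ENNReal.ofReal C)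
    (h : ∀ t : ℝ, t < 0 → ∫ x : ℝ, Complex.exp (-(Complex.I * t * x)) * v x = 0) :
    IsStrongBoundaryValue m fun x => Complex.exp (-(Complex.I * m * x)) * v x := by
  have hexp : ∀ z : ℂ, Complex.exp (-(Complex.I * m * z)) =
      Complex.exp (Complex.I * ((-m : ℝ) : ℂ) * z) := fun z => by push_cast; ring_nf
  refine ⟨fun z => Complex.exp (-(Complex.I * m * z)) * poissonExt v z, ⟨?_, C, hC0, ?_⟩, ?_⟩
  · exact DifferentiableOn.mul (Differentiable.differentiableOn (by fun_prop))
      (differentiableOn_poissonExt hv h)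
  · intro y _
    simp_rw [hexp, enorm_sq_exp_mul]
    rw [lintegral_const_mul' _ _ ENNReal.ofReal_ne_top, mul_comm C,
      ENNReal.ofReal_mul (Real.exp_pos _).le]
    refine mul_le_mul' (le_of_eq ?_) ((lintegral_sq_poissonExt_le hc y).trans hC)
    congr 2; ring
  · intro x
    have hcont : Continuous fun z : ℂ => Complex.exp (-(Complex.I * m * z)) * poissonExt v z :=
      Continuous.mul (by fun_prop) (continuous_poissonExt hc hB)
    have := (hcont.tendsto (x : ℂ)).mono_left (nhdsWithin_le_nhds (s := {z : ℂ | 0 < z.im}))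
    rwa [poissonExt_ofReal] at this

/-- If `g = v - i H v`, then `g` is the boundary function of `(πi)⁻¹ ∫ v(u) / (u - z) du`. -/
lemma IsHilbertPair.isWeakBoundaryValue {m : ℝ} (hm : 0 < m) {g : ℝ → ℂ} (hc : Continuous g)
    {B : ℝ} (hB : ∀ x, ‖g x‖ ≤ B) (hg : Integrable g) {C : ℝ} (hC0 : 0 < C)
    (hC : ∫⁻ x, ‖g x‖ₑ ^ 2 ≤ ENNReal.ofReal C) (h : IsHilbertPair g) :
    IsWeakBoundaryValue m g := by
  obtain ⟨v, w, -, -, hvw, hH, -⟩ := h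
  have hre : v = fun x => (g x).re := by
    funext x; rw [hvw x]; simp
  have hvc : Continuous v := by rw [hre]; fun_prop
  have hvi : Integrable v := by rw [hre]; exact hg.re
  have hvB : ∀ x, |v x| ≤ B := fun x => by
    rw [hre]; exact (Complex.abs_re_le_norm _).trans (hB x)
  have hvC : ∫⁻ x, ‖(v x : ℂ)‖ₑ ^ 2 ≤ ENNReal.ofReal C := by
    refine (lintegral_mono fun x => ?_).trans hC
    gcongr
    rw [← ofReal_norm, ← ofReal_norm, Complex.norm_real, hre]
    exact ENNReal.ofReal_le_ofReal (Complex.abs_re_le_norm _)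
  refine ⟨hilbertExt v, ⟨differentiableOn_hilbertExt hvi, 2 * C, by positivity, fun y hy => ?_⟩, ?_⟩
  · refine (lintegral_sq_hilbertExt_le hvi hvc hC0.le hvC hy).trans ?_
    refine ENNReal.ofReal_le_ofReal (le_mul_of_one_le_right (by positivity) ?_)
    exact Real.one_le_exp (by positivity)
  · filter_upwards [hH] with x hx
    have h1 : Tendsto (fun y : ℝ => poissonExt (fun u => (v u : ℂ)) ((x : ℂ) + Complex.I * (y : ℂ)))
        (𝓝[>] 0) (𝓝 (v x : ℂ)) := by
      have hcont := continuous_poissonExt (v := fun u => (v u : ℂ)) (by fun_prop) (B := B)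
        (fun u => by simpa using hvB u)
      have := (hcont.tendsto (x : ℂ)).comp ((tendsto_vertical x).mono_right nhdsWithin_le_nhds)
      rwa [poissonExt_ofReal] at this
    have h2 := (Complex.continuous_ofReal.tendsto _).comp (tendsto_conjPoisson hvi hvc hvB hx)
    have h3 := h1.sub (h2.const_mul Complex.I)
    rw [← hvw x] at h3
    refine h3.congr' ?_
    filter_upwards [self_mem_nhdsWithin] with y hy
    rw [hilbertExt_eq hvi x hy]
    rfl

/-- The zero function is a Hilbert pair. -/
lemma isHilbertPair_zero : IsHilbertPair fun _ => 0 := by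
  have h0 : IsHilbertTransform (fun _ => 0) fun _ => 0 :=
    Eventually.of_forall fun y => by simp
  refine ⟨fun _ => 0, fun _ => 0, MemLp.zero', MemLp.zero', by simp, h0, by simpa using h0⟩

/-- A continuous integrable function that is real-valued and has no negative frequencies has no
positive ones either, so it is zero. -/
lemma eq_zero_of_real_of_integral_exp_eq_zero {v : ℝ → ℂ} (hc : Continuous v) (hv : Integrable v)
    (hreal : ∀ x, (v x).im = 0)
    (h : ∀ t : ℝ, t < 0 → ∫ x : ℝ, Complex.exp (-(Complex.I * t * x)) * v x = 0) : v = 0 := by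
  have hpos : ∀ t : ℝ, 0 < t → ∫ x : ℝ, Complex.exp (-(Complex.I * t * x)) * v x = 0 := by
    intro t ht
    have h1 := congrArg (starRingEnd ℂ) (h (-t) (by linarith))
    rw [← integral_conj, map_zero] at h1
    rw [← h1]
    refine integral_congr_ae (Eventually.of_forall fun x => ?_)
    dsimp only
    rw [map_mul, ← Complex.exp_conj, Complex.conj_eq_iff_im.2 (hreal x)]
    simp
  have hF : FourierTransform.fourier v =ᵐ[volume] 0 := by
    have hne : ∀ᵐ t : ℝ, t ≠ 0 := by simp [ae_iff]
    filter_upwards [hne] with t ht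
    have hzero : ∫ x : ℝ, Complex.exp (-(Complex.I * ((2 * Real.pi * t : ℝ) : ℂ) * x)) * v x = 0 := by
      rcases lt_or_gt_of_ne ht with ht | ht
      · exact h _ (by have := Real.pi_pos; nlinarith)
      · exact hpos _ (by have := Real.pi_pos; positivity)
    rw [Real.fourier_eq', Pi.zero_apply, ← hzero]
    refine integral_congr_ae (Eventually.of_forall fun x => ?_)
    simp only [smul_eq_mul, RCLike.inner_apply, conj_trivial]
    push_cast
    ring_nf
  have hinv := hc.fourierInv_fourier_eq hv ((integrable_zero ℝ ℂ volume).congr hF.symm)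
  rw [← hinv]
  funext x
  rw [Real.fourierInv_eq', Pi.zero_apply]
  refine integral_eq_zero_of_ae ?_
  filter_upwards [hF] with t ht
  rw [ht]; simp

/-! ### The convolution and its frequencies -/

section

variable {f : ℝ → ℂ} {σ m : ℝ}

lemma norm_convIbar (f : ℝ → ℂ) (σ m x : ℝ) : ‖convIbar f σ m x‖ = ‖convI f σ x‖ := by
  rw [convIbar, norm_mul, Complex.norm_exp]; simp

lemma im_convI (hf : ∀ x, (f x).im = 0) (x : ℝ) : (convI f σ x).im = 0 := by
  have h : convI f σ x = ((∫ u : ℝ, (f u).re * (expKernel σ (x - u)).re : ℝ) : ℂ) := by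
    rw [convI, ← integral_complex_ofReal]
    refine integral_congr_ae (Eventually.of_forall fun u => ?_)
    refine Complex.ext ?_ ?_ <;> simp [hf u, im_expKernel]
  rw [h, Complex.ofReal_im]

lemma fourierT_eq_zero_iff (g : ℝ → ℂ) (t : ℝ) :
    fourierT g t = 0 ↔ ∫ x : ℝ, Complex.exp (-(Complex.I * t * x)) * g x = 0 := by
  have : ((1 / Real.sqrt (2 * Real.pi) : ℝ) : ℂ) ≠ 0 := by
    have : 0 < 1 / Real.sqrt (2 * Real.pi) := by positivity
    exact_mod_cast this.ne'
  rw [fourierT, mul_eq_zero, or_iff_right this]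

lemma fourierT_convIbar_eq_zero_iff :
    (∀ t : ℝ, t < -m → fourierT (convIbar f σ m) t = 0) ↔
      ∀ t : ℝ, t < 0 → ∫ x : ℝ, Complex.exp (-(Complex.I * t * x)) * convI f σ x = 0 := by
  have key : ∀ t : ℝ, fourierT (convIbar f σ m) t = 0 ↔
      ∫ x : ℝ, Complex.exp (-(Complex.I * ((t + m : ℝ) : ℂ) * x)) * convI f σ x = 0 := by
    intro t
    rw [fourierT_eq_zero_iff]
    have h : ∀ x : ℝ, Complex.exp (-(Complex.I * t * x)) * convIbar f σ m x =
        Complex.exp (-(Complex.I * ((t + m : ℝ) : ℂ) * x)) * convI f σ x := by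
      intro x
      rw [convIbar, ← mul_assoc, ← Complex.exp_add]
      congr 2
      push_cast
      ring
    simp_rw [h]
  constructor
  · intro h t ht
    have := (key (t - m)).1 (h _ (by linarith))
    rwa [sub_add_cancel] at this
  · intro h t ht
    exact (key t).2 (h _ (by linarith))

end

end

theorem theorem1p2 (σ m : ℝ) (hσ₁ : 1 / 2 < σ) (hσ₂ : σ < 1) (hm : 0 < m)
    (f : ℝ → ℂ) (hf : Integrable f volume) :
    -- the convolution integral converges everywhere, and the resulting function is in L¹ and L²
    (∀ x : ℝ, Integrable (fun u : ℝ => f u * expKernel σ (x - u)) volume) ∧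
    Integrable (convIbar f σ m) volume ∧
    MemLp (convIbar f σ m) 2 volume ∧
    -- condition (ii), with either sense of the limit as z tends to x
    List.TFAE [IsStrongBoundaryValue m (convIbar f σ m),
      IsWeakBoundaryValue m (convIbar f σ m),
      ∀ t : ℝ, t < -m → fourierT (convIbar f σ m) t = 0] ∧
    -- condition (i): sufficient always, necessary and sufficient for real-valued f
    (IsHilbertPair (convIbar f σ m) → IsStrongBoundaryValue m (convIbar f σ m)) ∧
    ((∀ x : ℝ, (f x).im = 0) →
      (IsStrongBoundaryValue m (convIbar f σ m) ↔ IsHilbertPair (convIbar f σ m))) ∧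
    -- condition (iii), under the Riemann hypothesis
    (RiemannHypothesis →
      (IsStrongBoundaryValue m (convIbar f σ m) ↔ ∀ t : ℝ, t < 0 → fourierT f t = 0)) := by
  have hc := continuous_convI hσ₁ hσ₂ hf
  obtain ⟨B, hB⟩ := exists_norm_convI_le hσ₁ hσ₂ hf
  have hI := integrable_convI hσ₁ hσ₂ hf
  have hcbar : Continuous (convIbar f σ m) := by unfold convIbar; fun_prop
  have hBbar : ∀ x, ‖convIbar f σ m x‖ ≤ B := fun x => (norm_convIbar f σ m x).trans_le (hB x)
  have hIbar : Integrable (convIbar f σ m) := hI.norm.mono' hcbar.aestronglyMeasurable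
    (Eventually.of_forall fun x => (norm_convIbar f σ m x).le)
  have hI2 : Integrable fun x => ‖convI f σ x‖ ^ 2 := by
    refine (hI.norm.const_mul B).mono' (hc.norm.pow 2).aestronglyMeasurable
      (Eventually.of_forall fun x => ?_)
    rw [Real.norm_of_nonneg (by positivity), pow_two]
    exact mul_le_mul_of_nonneg_right (hB x) (norm_nonneg _)
  -- The growth condition asks for a positive constant, also when the convolution vanishes.
  set C : ℝ := (∫ x, ‖convI f σ x‖ ^ 2) + 1 with hCdef
  have hC0 : 0 < C := by positivity
  have hC : ∫⁻ x, ‖convI f σ x‖ₑ ^ 2 ≤ ENNReal.ofReal C := by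
    have h1 : ∫⁻ x, ‖convI f σ x‖ₑ ^ 2 = ENNReal.ofReal (∫ x, ‖convI f σ x‖ ^ 2) := by
      rw [ofReal_integral_eq_lintegral_ofReal hI2 (Eventually.of_forall fun x => by positivity)]
      refine lintegral_congr fun x => ?_
      rw [ENNReal.ofReal_pow (norm_nonneg _), ofReal_norm]
    rw [h1]
    exact ENNReal.ofReal_le_ofReal (by linarith)
  have hCbar : ∫⁻ x, ‖convIbar f σ m x‖ₑ ^ 2 ≤ ENNReal.ofReal C := by
    refine le_of_eq_of_le (lintegral_congr fun x => ?_) hC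
    rw [← ofReal_norm, norm_convIbar, ofReal_norm]
  have hweak : IsWeakBoundaryValue m (convIbar f σ m) →
      ∀ t : ℝ, t < 0 → ∫ x : ℝ, Complex.exp (-(Complex.I * t * x)) * convI f σ x = 0 :=
    fun h t ht => h.integral_exp_eq_zero hI hI2 ht
  have hstrong : (∀ t : ℝ, t < 0 →
      ∫ x : ℝ, Complex.exp (-(Complex.I * t * x)) * convI f σ x = 0) →
      IsStrongBoundaryValue m (convIbar f σ m) :=
    fun h => isStrongBoundaryValue_of_integral_exp_eq_zero hc hB hI hC0 hC h
  have hiff : IsStrongBoundaryValue m (convIbar f σ m) ↔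
      ∀ t : ℝ, t < 0 → ∫ x : ℝ, Complex.exp (-(Complex.I * t * x)) * convI f σ x = 0 :=
    ⟨fun h => hweak h.isWeakBoundaryValue, hstrong⟩
  have hpair : IsHilbertPair (convIbar f σ m) → IsStrongBoundaryValue m (convIbar f σ m) :=
    fun h => hstrong (hweak (h.isWeakBoundaryValue hm hcbar hBbar hIbar hC0 hCbar))
  refine ⟨integrable_mul_expKernel hσ₁ hσ₂ hf, hIbar, ?_, ?_, hpair, fun hreal => ⟨fun h => ?_, hpair⟩,
    fun hRH => ?_⟩
  · rw [memLp_two_iff_integrable_sq_norm hcbar.aestronglyMeasurable]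
    simp_rw [norm_convIbar]
    exact hI2
  · tfae_have 1 → 2 := fun h => h.isWeakBoundaryValue
    tfae_have 2 → 3 := fun h => fourierT_convIbar_eq_zero_iff.2 (hweak h)
    tfae_have 3 → 1 := fun h => hstrong (fourierT_convIbar_eq_zero_iff.1 h)
    tfae_finish
  -- For real `f` the convolution is real, so a one-sided spectrum forces it to vanish.
  · have hzero := eq_zero_of_real_of_integral_exp_eq_zero hc hI (im_convI hreal) (hiff.1 h)
    have : convIbar f σ m = fun _ => 0 := by
      funext x; rw [convIbar, hzero]; simp
    rw [this]
    exact isHilbertPair_zero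
  · rw [hiff]
    refine forall₂_congr fun t _ => ?_
    rw [integral_exp_mul_convI hσ₁ hσ₂ hf, fourierT_eq_zero_iff, mul_eq_zero,
      or_iff_left (integral_exp_mul_expKernel_ne_zero hσ₁ hσ₂ hRH t)]
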